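/- Let $n\in\mathbb N$, let $V^*\cong\mathbb R^{n+1}$ with a fixed basis $\{\phi^0,\phi^1,\dots,\phi^n\}$, and let $F:V^*\to\mathbb R$ be an anisotropic area integrand: $F$ is positive away from $0$, convex, $C^3$ on $V^*\setminus\{0\}$, satisfies $F(\lambda v)=\lambda F(v)$ for all $\lambda>0$, and each body $\{F\le\lambda\}$, $\lambda>0$, is uniformly convex (the normal curvatures of its boundary $\{F=\lambda\}$ are bounded below by a positive constant). Assume the symmetry condition $$F(p+\phi^0)=F(p-\phi^0)\qquad\text{for all }p=\sum_{i=1}^n p_i\phi^i .$$ Let $u:\mathbb R^n\times[0,T]\to\mathbb R$ be a $C^3$ solution of the anisotropic mean curvature flow $$u_t=\sum_{i,j=1}^n F(\nu)\,D^2F|_{\nu}(\phi^i,\phi^j)\,u_{ij},\qquad \nu=Du-\phi^0=\sum_{i=1}^n u_i\phi^i-\phi^0,$$ with $|u(x,t)|\le M$ on $\mathbb R^n\times[0,T]$, which is spatially periodic: $u(x+\ell,t)=u(x,t)$ for all $\ell$ in some (full-rank) lattice $L\subset\mathbb R^n$. Then $$F(Du(x,t)-\phi^0)\le\max\left\{t\,\exp\left(\frac{A(|u(x,t)|-2M)^2}{2t}\right),\,S\right\}$$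 for all $x\in\mathbb R^n$ and all $0<t\le T'$ with $t\le T$. Here $T'>0$ depends only on $M$, $A>0$ depends only on $F$, and $S>0$ depends only on $F$ and $n$ (with the basis $\{\phi^i\}$ fixed); in particular $A$ and $S$ do not depend on $u$, $M$, $T$ or $L$. -/

import Mathlib

open Set

/-- The cotangent space `V* ≅ ℝ^{n+1}`, with the Euclidean norm. -/
abbrev Cotangent (n : ℕ) : Type := EuclideanSpace ℝ (Fin (n + 1))

/-- The second derivative `D²f|ₓ` as a bilinear map: `hess f x v w = D²f|ₓ(v, w)`. -/
noncomputable def hess {E : Type*} [NormedAddCommGroup E] [NormedSpace ℝ E]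
    (f : E → ℝ) (x : E) : E →L[ℝ] E →L[ℝ] ℝ :=
  fderiv ℝ (fderiv ℝ f) x

/-- The normal curvature, with respect to the inner normal of `{F ≤ F v}`, of the level set of `F`
through `v` in the tangent direction `w` (meaningful when `DF|ᵥ ≠ 0`, `w ≠ 0` and `DF|ᵥ(w) = 0`). -/
noncomputable def levelNormalCurvature {n : ℕ} (F : Cotangent n → ℝ) (v w : Cotangent n) : ℝ :=
  hess F v w w / (‖fderiv ℝ F v‖ * ‖w‖ ^ 2)

/-- The convex body `{F ≤ l}` is uniformly convex: the normal curvatures of its boundary,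
the level set `{F = l}`, are bounded below by a positive constant. -/
def UniformlyConvexSublevel {n : ℕ} (F : Cotangent n → ℝ) (l : ℝ) : Prop :=
  ∃ κ : ℝ, 0 < κ ∧ ∀ v : Cotangent n, F v = l →
    ∀ w : Cotangent n, w ≠ 0 → fderiv ℝ F v w = 0 → κ ≤ levelNormalCurvature F v w

/-- Anisotropic area integrands on `V*`: positive (away from the origin), convex, `C³` away from
the origin, positively homogeneous of degree one, with uniformly convex sublevel sets. -/
structure IsAnisotropicIntegrand {n : ℕ} (F : Cotangent n → ℝ) : Prop where
  pos : ∀ v : Cotangent n, v ≠ 0 → 0 < F v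
  convex : ConvexOn ℝ univ F
  contDiffOn : ContDiffOn ℝ 3 F {0}ᶜ
  homogeneous : ∀ l : ℝ, 0 < l → ∀ v : Cotangent n, F (l • v) = l * F v
  uniformlyConvex : ∀ l : ℝ, 0 < l → UniformlyConvexSublevel F l

/-- The symmetry condition `F(p + φ⁰) = F(p - φ⁰)` for all `p = ∑_{i=1}^n p_i φ^i`. -/
def SymmetryCondition {n : ℕ} (φ : Module.Basis (Fin (n + 1)) ℝ (Cotangent n))
    (F : Cotangent n → ℝ) : Prop :=
  ∀ c : Fin n → ℝ,
    F ((∑ i, c i • φ i.succ) + φ 0) = F ((∑ i, c i • φ i.succ) - φ 0)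

/-- The `i`-th standard basis vector of `ℝⁿ`. -/
noncomputable def stdVec {n : ℕ} (i : Fin n) : EuclideanSpace ℝ (Fin n) :=
  EuclideanSpace.single i 1

/-- The conormal `Df - φ⁰ = ∑_{i=1}^n f_i φ^i - φ⁰` of the graph of `f : ℝⁿ → ℝ` at `x`. -/
noncomputable def conormal {n : ℕ} (φ : Module.Basis (Fin (n + 1)) ℝ (Cotangent n))
    (f : EuclideanSpace ℝ (Fin n) → ℝ) (x : EuclideanSpace ℝ (Fin n)) : Cotangent n :=
  (∑ i, fderiv ℝ f x (stdVec i) • φ i.succ) - φ 0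

/-- The right-hand side `∑_{i,j=1}^n (F D²F)|_{Df - φ⁰}(φ^i, φ^j) f_{ij}` of the flow. -/
noncomputable def anisotropicSpeed {n : ℕ} (φ : Module.Basis (Fin (n + 1)) ℝ (Cotangent n))
    (F : Cotangent n → ℝ) (f : EuclideanSpace ℝ (Fin n) → ℝ)
    (x : EuclideanSpace ℝ (Fin n)) : ℝ :=
  ∑ i : Fin n, ∑ j : Fin n,
    F (conormal φ f x) * hess F (conormal φ f x) (φ i.succ) (φ j.succ) *
      hess f x (stdVec i) (stdVec j)

/-- `u : ℝⁿ × [0,T] → ℝ` is a (jointly) `C³` solution of the anisotropic mean curvature flow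
`u_t = (F D²F)|_{Du - φ⁰}(φ^i, φ^j) u_{ij}`; at `t = 0` and `t = T` the time derivative is
one-sided. The values of `u` at times outside `[0,T]` play no role. -/
structure IsFlowSolution {n : ℕ} (φ : Module.Basis (Fin (n + 1)) ℝ (Cotangent n))
    (F : Cotangent n → ℝ) (T : ℝ) (u : EuclideanSpace ℝ (Fin n) → ℝ → ℝ) : Prop where
  contDiffOn : ContDiffOn ℝ 3 (fun z : EuclideanSpace ℝ (Fin n) × ℝ => u z.1 z.2)
    (univ ×ˢ Icc 0 T)
  equation : ∀ x : EuclideanSpace ℝ (Fin n), ∀ t ∈ Icc (0 : ℝ) T,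
    HasDerivWithinAt (fun s => u x s) (anisotropicSpeed φ F (fun y => u y t) x) (Icc 0 T) t

/-! ### Derivatives up to third order: symmetries, and transformation under linear maps. -/

section Equivariance

variable {E : Type*} [NormedAddCommGroup E] [NormedSpace ℝ E]

/-! The proof is a maximum principle for r / g(u, t), where r = F(ν) and g is `barrier` with centre
σ = ±2M. As g blows up when t → 0, no initial gradient bound is needed. Suppose the ratio attains a
maximum m > 1, and write g for m times the barrier. With p = Du and ξ_i = DF(φ^i), the first-order
condition is D²u ξ = g'(u) p. The second-order condition, traced against G_ij = D²F(φ^i, φ^j),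
removes the third derivatives of u. What remains (`exists_speed_deriv_le`) is r_t − g' u_t ≤ θ (g''
− (3/2) g'²/r), where θ = r D²F(φ⁰, φ⁰) ≥ c0 > 0.

With q = u − σ, the bracket equals A r (2t − A q²)/(2t²), while g_t = r (2t − A q²)/(2t²). For small
t and large A one has A q² > 2t and θA > 1, which contradicts r_t − g' u_t ≥ g_t.

The coefficient 3/2 only has to exceed 1. By Euler's relations D³F(φ⁰, p, p), with p read as the
covector ν + φ⁰, contains −2D²F(φ⁰, φ⁰), which would give the coefficient 2. All other terms are
errors, small for large r by the symmetry: DF(φ⁰), D³F(φ⁰, φ^i, φ^j) and D³F(φ⁰, φ⁰, φ⁰) vanish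
where the φ⁰-coordinate is zero, and ν/r approaches that hyperplane (`exists_asymptotics`). D²u is
split into a multiple of p ⊗ p and a tensor K annihilating ξ. Uniform convexity controls K by the
good quadratic term tr(GKGK) (`reaction_le`). -/

theorem ContDiffAt.hasFDerivAt_fderiv_apply {f : E → ℝ} {x : E} (hf : ContDiffAt ℝ 2 f x) (w : E) :
    HasFDerivAt (fun y => fderiv ℝ f y w)
      ((ContinuousLinearMap.apply ℝ ℝ w).comp (hess f x)) x := by
  have h : HasFDerivAt (fderiv ℝ f) (hess f x) x :=
    ((hf.fderiv_right (m := 1) (by norm_num)).differentiableAt (by norm_num)).hasFDerivAt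
  exact (ContinuousLinearMap.apply ℝ ℝ w).hasFDerivAt.comp x h

theorem ContDiffAt.hasFDerivAt_hess_apply {f : E → ℝ} {x : E} (hf : ContDiffAt ℝ 3 f x) (w z : E) :
    HasFDerivAt (fun y => hess f y w z)
      ((ContinuousLinearMap.apply ℝ ℝ z).comp
        ((ContinuousLinearMap.apply ℝ (E →L[ℝ] ℝ) w).comp (fderiv ℝ (hess f) x))) x := by
  have h : HasFDerivAt (hess f) (fderiv ℝ (hess f) x) x :=
    (((hf.fderiv_right (m := 2) (by norm_num)).fderiv_right (m := 1)
      (by norm_num)).differentiableAt (by norm_num)).hasFDerivAt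
  have h' : HasFDerivAt (fun y => hess f y w)
      ((ContinuousLinearMap.apply ℝ (E →L[ℝ] ℝ) w).comp (fderiv ℝ (hess f) x)) x :=
    HasFDerivAt.comp (g := ContinuousLinearMap.apply ℝ (E →L[ℝ] ℝ) w) x
      (ContinuousLinearMap.hasFDerivAt _) h
  exact (ContinuousLinearMap.apply ℝ ℝ z).hasFDerivAt.comp x h'

set_option maxSynthPendingDepth 5 in
theorem ContDiffAt.continuousAt_fderiv_hess_apply {f : E → ℝ} {x : E} (hf : ContDiffAt ℝ 3 f x)
    (w z y : E) : ContinuousAt (fun v => fderiv ℝ (hess f) v w z y) x := by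
  have h :=
    (((hf.fderiv_right (m := 2) (by norm_num)).fderiv_right (m := 1)
      (by norm_num)).fderiv_right (m := 0) (by norm_num)).continuousAt
  exact ((h.clm_apply continuousAt_const).clm_apply continuousAt_const).clm_apply
    continuousAt_const

theorem hess_symm {f : E → ℝ} {x : E} (hf : ContDiffAt ℝ 2 f x) (v w : E) :
    hess f x v w = hess f x w v :=
  (hf.isSymmSndFDerivAt (by simp)).eq v w

theorem fderiv_hess_symm_right {f : E → ℝ} {x : E} (hf : ContDiffAt ℝ 3 f x) (v w z : E) :
    fderiv ℝ (hess f) x v w z = fderiv ℝ (hess f) x v z w := by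
  have h1 := hf.hasFDerivAt_hess_apply w z
  have h2 := hf.hasFDerivAt_hess_apply z w
  have h3 : (fun y => hess f y w z) =ᶠ[nhds x] (fun y => hess f y z w) := by
    filter_upwards [hf.eventually (by simp)] with y hy
    exact hess_symm (hy.of_le (by norm_num)) w z
  have := (h1.congr_of_eventuallyEq h3.symm).unique h2
  simpa using congrArg (fun L : E →L[ℝ] ℝ => L v) this

theorem fderiv_hess_symm_left {f : E → ℝ} {x : E} (hf : ContDiffAt ℝ 3 f x) (v w z : E) :
    fderiv ℝ (hess f) x v w z = fderiv ℝ (hess f) x w v z := by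
  have := ((hf.fderiv_right (m := 2) (by norm_num)).isSymmSndFDerivAt (by simp)).eq v w
  exact congrArg (fun L : E →L[ℝ] ℝ => L z) this

/-- If `F ∘ e = c F` for a linear isomorphism `e`, so it is for the derivatives of `F`. -/
theorem fderiv_apply_of_equivariant {F : E → ℝ} {e : E ≃L[ℝ] E} {c : ℝ}
    (h : ∀ v, F (e v) = c * F v) (hF : ∀ v ≠ 0, ContDiffAt ℝ 3 F v) {v : E} (hv : v ≠ 0) (w : E) :
    fderiv ℝ F (e v) (e w) = c * fderiv ℝ F v w := by
  have hev : e v ≠ 0 := by simpa using hv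
  have h1 : HasFDerivAt (fun x => F (e x)) ((fderiv ℝ F (e v)).comp (e : E →L[ℝ] E)) v :=
    ((hF _ hev).differentiableAt (by norm_num)).hasFDerivAt.comp v e.hasFDerivAt
  have h2 : HasFDerivAt (fun x => F (e x)) (c • fderiv ℝ F v) v := by
    simp_rw [h]
    exact ((hF _ hv).differentiableAt (by norm_num)).hasFDerivAt.const_mul c
  simpa using congrArg (fun L : E →L[ℝ] ℝ => L w) (h1.unique h2)

theorem hess_apply_of_equivariant {F : E → ℝ} {e : E ≃L[ℝ] E} {c : ℝ}
    (h : ∀ v, F (e v) = c * F v) (hF : ∀ v ≠ 0, ContDiffAt ℝ 3 F v) {v : E} (hv : v ≠ 0)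
    (w z : E) : hess F (e v) (e w) (e z) = c * hess F v w z := by
  have hev : e v ≠ 0 := by simpa using hv
  have h1 := (((hF _ hev).of_le (by norm_num)).hasFDerivAt_fderiv_apply (e z)).comp v e.hasFDerivAt
  have h2 := (((hF _ hv).of_le (by norm_num)).hasFDerivAt_fderiv_apply z).const_mul c
  have h3 : ((fun y => fderiv ℝ F y (e z)) ∘ e) =ᶠ[nhds v] (fun y => c * fderiv ℝ F y z) := by
    filter_upwards [isOpen_ne.mem_nhds hv] with y hy
    exact fderiv_apply_of_equivariant h hF hy z
  simpa using congrArg (fun L : E →L[ℝ] ℝ => L w)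
    ((h1.congr_of_eventuallyEq h3.symm).unique h2)

theorem fderiv_hess_apply_of_equivariant {F : E → ℝ} {e : E ≃L[ℝ] E} {c : ℝ}
    (h : ∀ v, F (e v) = c * F v) (hF : ∀ v ≠ 0, ContDiffAt ℝ 3 F v) {v : E} (hv : v ≠ 0)
    (w z y : E) :
    fderiv ℝ (hess F) (e v) (e w) (e z) (e y) = c * fderiv ℝ (hess F) v w z y := by
  have hev : e v ≠ 0 := by simpa using hv
  have h1 := ((hF _ hev).hasFDerivAt_hess_apply (e z) (e y)).comp v e.hasFDerivAt
  have h2 := ((hF _ hv).hasFDerivAt_hess_apply z y).const_mul c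
  have h3 : ((fun x => hess F x (e z) (e y)) ∘ e) =ᶠ[nhds v] (fun x => c * hess F x z y) := by
    filter_upwards [isOpen_ne.mem_nhds hv] with x hx
    exact hess_apply_of_equivariant h hF hx z y
  simpa using congrArg (fun L : E →L[ℝ] ℝ => L w)
    ((h1.congr_of_eventuallyEq h3.symm).unique h2)

end Equivariance

/-! ### Homogeneity of the derivatives of F and Euler's relations. -/

namespace IsAnisotropicIntegrand

variable {n : ℕ} {F : Cotangent n → ℝ}

theorem contDiffAt (hF : IsAnisotropicIntegrand F) (v : Cotangent n) (hv : v ≠ 0) :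
    ContDiffAt ℝ 3 F v :=
  hF.contDiffOn.contDiffAt (isOpen_compl_singleton.mem_nhds hv)

theorem continuous (hF : IsAnisotropicIntegrand F) : Continuous F :=
  continuousOn_univ.1 (hF.convex.continuousOn isOpen_univ)

theorem map_zero (hF : IsAnisotropicIntegrand F) : F 0 = 0 := by
  have := hF.homogeneous 2 (by norm_num) 0
  simp at this
  linarith

/-- Homogeneity is equivariance under the isomorphism l · with c = l; the same lemmas with c = 1
serve the reflection below. -/
theorem fderiv_smul (hF : IsAnisotropicIntegrand F) {l : ℝ} (hl : 0 < l) {v : Cotangent n}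
    (hv : v ≠ 0) (w : Cotangent n) : fderiv ℝ F (l • v) w = fderiv ℝ F v w := by
  have := fderiv_apply_of_equivariant (F := F)
    (e := ContinuousLinearEquiv.smulLeft (R₁ := ℝ) (M₁ := Cotangent n) (Units.mk0 l hl.ne')) (c := l)
    (fun v => hF.homogeneous l hl v) hF.contDiffAt hv w
  simp [Units.smul_def] at this
  exact this.resolve_right hl.ne'

theorem hess_smul (hF : IsAnisotropicIntegrand F) {l : ℝ} (hl : 0 < l) {v : Cotangent n}
    (hv : v ≠ 0) (w z : Cotangent n) : l * hess F (l • v) w z = hess F v w z := by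
  have := hess_apply_of_equivariant (F := F)
    (e := ContinuousLinearEquiv.smulLeft (R₁ := ℝ) (M₁ := Cotangent n) (Units.mk0 l hl.ne')) (c := l)
    (fun v => hF.homogeneous l hl v) hF.contDiffAt hv w z
  simp [Units.smul_def] at this
  exact this.resolve_right hl.ne'

theorem fderiv_hess_smul (hF : IsAnisotropicIntegrand F) {l : ℝ} (hl : 0 < l) {v : Cotangent n}
    (hv : v ≠ 0) (w z y : Cotangent n) :
    l ^ 2 * fderiv ℝ (hess F) (l • v) w z y = fderiv ℝ (hess F) v w z y := by
  have := fderiv_hess_apply_of_equivariant (F := F)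
    (e := ContinuousLinearEquiv.smulLeft (R₁ := ℝ) (M₁ := Cotangent n) (Units.mk0 l hl.ne')) (c := l)
    (fun v => hF.homogeneous l hl v) hF.contDiffAt hv w z y
  simp [Units.smul_def] at this
  rw [← this.resolve_right hl.ne']
  ring

theorem hasDerivAt_smul_one (v : Cotangent n) :
    HasDerivAt (fun l : ℝ => l • v) v 1 := by
  simpa using (hasDerivAt_id (1 : ℝ)).smul_const v

theorem fderiv_self (hF : IsAnisotropicIntegrand F) {v : Cotangent n} (hv : v ≠ 0) :
    fderiv ℝ F v v = F v := by
  have h0 : HasFDerivAt F (fderiv ℝ F v) ((1 : ℝ) • v) := by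
    rw [one_smul]; exact ((hF.contDiffAt v hv).differentiableAt (by norm_num)).hasFDerivAt
  have h1 := h0.comp_hasDerivAt (1 : ℝ) (hasDerivAt_smul_one v)
  have h2 : HasDerivAt (fun l : ℝ => l * F v) (F v) 1 := by
    simpa using (hasDerivAt_id (1 : ℝ)).mul_const (F v)
  refine h1.unique (h2.congr_of_eventuallyEq ?_)
  filter_upwards [lt_mem_nhds (zero_lt_one' ℝ)] with l hl
  exact hF.homogeneous l hl v

theorem hess_self (hF : IsAnisotropicIntegrand F) {v : Cotangent n} (hv : v ≠ 0)
    (w : Cotangent n) : hess F v v w = 0 := by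
  have h0 : HasFDerivAt (fun y => fderiv ℝ F y w)
      ((ContinuousLinearMap.apply ℝ ℝ w).comp (hess F v)) ((1 : ℝ) • v) := by
    rw [one_smul]
    exact ((hF.contDiffAt v hv).of_le (by norm_num)).hasFDerivAt_fderiv_apply w
  have h1 := h0.comp_hasDerivAt (1 : ℝ) (hasDerivAt_smul_one v)
  have h2 : HasDerivAt (fun _ : ℝ => fderiv ℝ F v w) 0 1 := hasDerivAt_const _ _
  refine h1.unique (h2.congr_of_eventuallyEq ?_)
  filter_upwards [lt_mem_nhds (zero_lt_one' ℝ)] with l hl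
  exact hF.fderiv_smul hl hv w

theorem hess_self_right (hF : IsAnisotropicIntegrand F) {v : Cotangent n} (hv : v ≠ 0)
    (w : Cotangent n) : hess F v w v = 0 := by
  rw [hess_symm ((hF.contDiffAt v hv).of_le (by norm_num)), hF.hess_self hv]

theorem fderiv_hess_self (hF : IsAnisotropicIntegrand F) {v : Cotangent n} (hv : v ≠ 0)
    (w z : Cotangent n) : fderiv ℝ (hess F) v v w z = -hess F v w z := by
  have h0 : HasFDerivAt (fun y => hess F y w z)
      ((ContinuousLinearMap.apply ℝ ℝ z).comp ((ContinuousLinearMap.apply ℝ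
        (Cotangent n →L[ℝ] ℝ) w).comp (fderiv ℝ (hess F) v))) ((1 : ℝ) • v) := by
    rw [one_smul]
    exact (hF.contDiffAt v hv).hasFDerivAt_hess_apply w z
  have h1 := h0.comp_hasDerivAt (1 : ℝ) (hasDerivAt_smul_one v)
  have h2 : HasDerivAt (fun l : ℝ => l⁻¹ * hess F v w z) (-hess F v w z) 1 := by
    simpa using (hasDerivAt_inv (one_ne_zero' ℝ)).mul_const (hess F v w z)
  refine h1.unique (h2.congr_of_eventuallyEq ?_)
  filter_upwards [lt_mem_nhds (zero_lt_one' ℝ)] with l hl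
  simp [← hF.hess_smul hl hv w z, hl.ne']

theorem fderiv_hess_apply_self (hF : IsAnisotropicIntegrand F) {v : Cotangent n} (hv : v ≠ 0)
    (w z : Cotangent n) : fderiv ℝ (hess F) v w v z = -hess F v w z := by
  rw [fderiv_hess_symm_left (hF.contDiffAt v hv), hF.fderiv_hess_self hv]

theorem fderiv_hess_apply_apply_self (hF : IsAnisotropicIntegrand F) {v : Cotangent n}
    (hv : v ≠ 0) (w z : Cotangent n) : fderiv ℝ (hess F) v w z v = -hess F v w z := by
  rw [fderiv_hess_symm_right (hF.contDiffAt v hv), hF.fderiv_hess_apply_self hv]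

end IsAnisotropicIntegrand

/-! ### The reflection symmetry of F and the derivatives it kills. -/

section Reflection

variable {n : ℕ} (φ : Module.Basis (Fin (n + 1)) ℝ (Cotangent n)) {F : Cotangent n → ℝ}

/-- The covector `∑ pᵢ φⁱ` with coordinates `p`. -/
noncomputable def horizontal (p : Fin n → ℝ) : Cotangent n := ∑ i, p i • φ i.succ

/-- The reflection of `V*` that maps `φ⁰` to `-φ⁰` and fixes the other basis vectors. -/
noncomputable def basisReflection : Cotangent n ≃L[ℝ] Cotangent n :=
  (φ.equivFun.trans ((LinearEquiv.piCongrRight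
    (fun i : Fin (n + 1) => if i = 0 then LinearEquiv.neg ℝ else LinearEquiv.refl ℝ ℝ)).trans
      φ.equivFun.symm)).toContinuousLinearEquiv

theorem basisReflection_zero : basisReflection φ (φ 0) = -φ 0 := by
  have : basisReflection φ (φ 0) = φ.equivFun.symm (-(Pi.single 0 1)) := by
    simp only [basisReflection, LinearEquiv.coe_toContinuousLinearEquiv', LinearEquiv.trans_apply]
    congr 1
    ext i
    refine Fin.cases ?_ (fun j => ?_) i <;> simp
  rw [this, map_neg]
  simp [Module.Basis.equivFun_symm_apply, Pi.single_apply]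

theorem basisReflection_succ (j : Fin n) : basisReflection φ (φ j.succ) = φ j.succ := by
  have : basisReflection φ (φ j.succ) = φ.equivFun.symm (Pi.single j.succ 1) := by
    simp only [basisReflection, LinearEquiv.coe_toContinuousLinearEquiv', LinearEquiv.trans_apply]
    congr 1
    ext i
    refine Fin.cases ?_ (fun k => ?_) i <;> simp [Finsupp.single_apply, Pi.single_apply, eq_comm]
  rw [this]
  simp [Module.Basis.equivFun_symm_apply, Pi.single_apply]

theorem basisReflection_horizontal (p : Fin n → ℝ) :
    basisReflection φ (horizontal φ p) = horizontal φ p := by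
  simp [horizontal, basisReflection_succ]

theorem eq_horizontal_add (v : Cotangent n) :
    v = horizontal φ (fun i => φ.coord i.succ v) + φ.coord 0 v • φ 0 := by
  conv_lhs => rw [← φ.sum_repr v, Fin.sum_univ_succ, add_comm]
  rfl

variable {φ}

/-- The hypothesis concerns φ⁰-coordinate ±1 only; homogeneity spreads it to every nonzero
coordinate, and on the hyperplane of coordinate zero the reflection is the identity. -/
theorem SymmetryCondition.comp_basisReflection (hs : SymmetryCondition φ F)
    (hF : IsAnisotropicIntegrand F) (v : Cotangent n) : F (basisReflection φ v) = F v := by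
  have key (p : Fin n → ℝ) (l : ℝ) (hl : 0 < l) :
      F (horizontal φ p + l • φ 0) = F (horizontal φ p - l • φ 0) := by
    have h := hs (fun i => l⁻¹ * p i)
    have h1 : ∑ i, (l⁻¹ * p i) • φ i.succ = l⁻¹ • horizontal φ p := by
      simp [horizontal, Finset.smul_sum, mul_smul]
    rw [h1] at h
    have h2 : horizontal φ p + l • φ 0 = l • (l⁻¹ • horizontal φ p + φ 0) := by
      simp [smul_smul, hl.ne']
    have h3 : horizontal φ p - l • φ 0 = l • (l⁻¹ • horizontal φ p - φ 0) := by
      simp [smul_sub, smul_smul, hl.ne']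
    rw [h2, h3, hF.homogeneous l hl, hF.homogeneous l hl, h]
  rw [eq_horizontal_add φ v]
  set p := fun i => φ.coord (Fin.succ i) v
  set l := φ.coord 0 v
  rw [map_add, map_smul, basisReflection_horizontal, basisReflection_zero]
  rcases lt_trichotomy l 0 with hl | hl | hl
  · have := key p (-l) (by linarith)
    simpa using this
  · simp [hl]
  · have := key p l hl
    simpa [sub_eq_add_neg] using this.symm

theorem basisReflection_eq_self {v : Cotangent n} (hv : φ.coord 0 v = 0) :
    basisReflection φ v = v := by
  rw [eq_horizontal_add φ v, hv]
  simp [basisReflection_horizontal]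

/-- The reflection fixes v and reverses φ⁰, so an expression odd in φ⁰ equals its own negative. The
next two lemmas are the same for third derivatives. -/
theorem SymmetryCondition.fderiv_eq_zero (hs : SymmetryCondition φ F)
    (hF : IsAnisotropicIntegrand F) {v : Cotangent n} (hv : v ≠ 0) (h0 : φ.coord 0 v = 0) :
    fderiv ℝ F v (φ 0) = 0 := by
  have := fderiv_apply_of_equivariant (F := F) (e := basisReflection φ) (c := 1)
    (fun v => by rw [hs.comp_basisReflection hF, one_mul]) hF.contDiffAt hv (φ 0)
  rw [basisReflection_eq_self h0, basisReflection_zero, map_neg] at this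
  linarith

theorem SymmetryCondition.fderiv_hess_eq_zero (hs : SymmetryCondition φ F)
    (hF : IsAnisotropicIntegrand F) {v : Cotangent n} (hv : v ≠ 0) (h0 : φ.coord 0 v = 0)
    (i j : Fin n) : fderiv ℝ (hess F) v (φ 0) (φ i.succ) (φ j.succ) = 0 := by
  have := fderiv_hess_apply_of_equivariant (F := F) (e := basisReflection φ) (c := 1)
    (fun v => by rw [hs.comp_basisReflection hF, one_mul]) hF.contDiffAt hv (φ 0)
      (φ i.succ) (φ j.succ)
  rw [basisReflection_eq_self h0, basisReflection_zero, basisReflection_succ,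
    basisReflection_succ, map_neg] at this
  simp at this
  linarith

theorem SymmetryCondition.fderiv_hess_zero_eq_zero (hs : SymmetryCondition φ F)
    (hF : IsAnisotropicIntegrand F) {v : Cotangent n} (hv : v ≠ 0) (h0 : φ.coord 0 v = 0) :
    fderiv ℝ (hess F) v (φ 0) (φ 0) (φ 0) = 0 := by
  have := fderiv_hess_apply_of_equivariant (F := F) (e := basisReflection φ) (c := 1)
    (fun v => by rw [hs.comp_basisReflection hF, one_mul]) hF.contDiffAt hv (φ 0) (φ 0) (φ 0)
  rw [basisReflection_eq_self h0, basisReflection_zero] at this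
  simp at this
  linarith

end Reflection

/-! ### Coercivity of D²F and asymptotics at steep conormals, by compactness of {F = 1}. -/

theorem IsCompact.exists_forall_abs_le_of_eq_zero {X : Type*} [TopologicalSpace X] {K : Set X}
    (hK : IsCompact K) {f g : X → ℝ} (hf : ContinuousOn f K) (hg : ContinuousOn g K)
    (h : ∀ x ∈ K, g x = 0 → f x = 0) {ε : ℝ} (hε : 0 < ε) :
    ∃ δ > 0, ∀ x ∈ K, |g x| ≤ δ → |f x| ≤ ε := by
  have hK' : IsCompact {x ∈ K | ε ≤ |f x|} := by
    obtain ⟨t, ht, e⟩ := continuousOn_iff_isClosed.1 hf.abs (Ici ε) isClosed_Ici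
    have e' : {x ∈ K | ε ≤ |f x|} = t ∩ K := by
      rw [← e]
      ext x
      simp [and_comm]
    rw [e']
    exact hK.inter_left ht
  rcases {x ∈ K | ε ≤ |f x|}.eq_empty_or_nonempty with he | hne
  · refine ⟨1, one_pos, fun x hx _ => ?_⟩
    by_contra hlt
    have : x ∈ {x ∈ K | ε ≤ |f x|} := ⟨hx, (not_le.1 hlt).le⟩
    simp [he] at this
  -- On the compact set {|f| ≥ ε} the minimum of |g| is positive, so half of it is a valid δ.
  · obtain ⟨x0, hx0, hmin⟩ := hK'.exists_isMinOn hne (hg.abs.mono (sep_subset _ _))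
    have hpos : 0 < |g x0| := by
      rw [abs_pos]
      intro h0
      have := hx0.2
      rw [h x0 hx0.1 h0, abs_zero] at this
      linarith
    refine ⟨|g x0| / 2, half_pos hpos, fun x hx hgx => ?_⟩
    by_contra hlt
    have h1 : |g x0| ≤ |g x| := hmin ⟨hx, (not_le.1 hlt).le⟩
    linarith

namespace IsAnisotropicIntegrand

variable {n : ℕ} {F : Cotangent n → ℝ}

theorem ne_zero_of_pos (hF : IsAnisotropicIntegrand F) {v : Cotangent n} (hv : 0 < F v) :
    v ≠ 0 := by
  rintro rfl
  rw [hF.map_zero] at hv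
  exact hv.false

theorem isCompact_levelSet (hF : IsAnisotropicIntegrand F) : IsCompact {v | F v = 1} := by
  refine Metric.isCompact_of_isClosed_isBounded (isClosed_eq hF.continuous continuous_const) ?_
  obtain ⟨x, hx, hmin⟩ := (isCompact_sphere (0 : Cotangent n) 1).exists_isMinOn
    (NormedSpace.sphere_nonempty.2 zero_le_one) hF.continuous.continuousOn
  have hx0 : 0 < F x := hF.pos x (ne_zero_of_mem_unit_sphere ⟨x, hx⟩)
  refine (Metric.isBounded_closedBall (x := (0 : Cotangent n)) (r := (F x)⁻¹)).subset ?_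
  intro v hv
  have hv' : F v = 1 := hv
  have hv0 : 0 < ‖v‖ := norm_pos_iff.2 (hF.ne_zero_of_pos (by rw [hv']; exact one_pos))
  have h1 : F x ≤ F (‖v‖⁻¹ • v) := hmin (by simp [norm_smul, hv0.ne'])
  rw [hF.homogeneous _ (by positivity), hv', mul_one] at h1
  rw [mem_closedBall_zero_iff]
  exact (le_inv_comm₀ hv0 hx0).2 h1

theorem inv_smul_mem_levelSet (hF : IsAnisotropicIntegrand F) {v : Cotangent n} (hv : v ≠ 0) :
    F ((F v)⁻¹ • v) = 1 := by
  rw [hF.homogeneous _ (inv_pos.2 (hF.pos v hv)), inv_mul_cancel₀ (hF.pos v hv).ne']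

/-- Euler's relation DF(η)η = 1 gives ‖DF‖ ≥ 1/R on {F = 1}, which turns the curvature bound into a
Hessian bound; since D²F has degree −1, it extends off the level set with weight 1/F. -/
theorem exists_hess_coercive (hF : IsAnisotropicIntegrand F) :
    ∃ c > 0, ∀ v ≠ 0, ∀ w, fderiv ℝ F v w = 0 → c / F v * ‖w‖ ^ 2 ≤ hess F v w w := by
  obtain ⟨R, hR0, hR⟩ := hF.isCompact_levelSet.isBounded.exists_pos_norm_le
  obtain ⟨κ, hκ, h⟩ := hF.uniformlyConvex 1 one_pos
  refine ⟨κ * R⁻¹, by positivity, fun v hv w hw => ?_⟩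
  have hFv := hF.pos v hv
  rcases eq_or_ne w 0 with rfl | hw0
  · simp
  have hη := hF.inv_smul_mem_levelSet hv
  set η := (F v)⁻¹ • v with hηd
  have hη0 : η ≠ 0 := hF.ne_zero_of_pos (by rw [hη]; exact one_pos)
  have h1 := h η hη w hw0 (by rw [hηd, hF.fderiv_smul (inv_pos.2 hFv) hv, hw])
  have h2 : 1 ≤ ‖fderiv ℝ F η‖ * R := by
    calc 1 = fderiv ℝ F η η := by rw [hF.fderiv_self hη0, hη]
      _ ≤ ‖fderiv ℝ F η η‖ := le_abs_self _
      _ ≤ ‖fderiv ℝ F η‖ * ‖η‖ := ContinuousLinearMap.le_opNorm _ _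
      _ ≤ _ := by gcongr; exact hR η hη
  have h3 : R⁻¹ ≤ ‖fderiv ℝ F η‖ := (inv_le_iff_one_le_mul₀ hR0).2 h2
  have hw' : 0 < ‖w‖ := norm_pos_iff.2 hw0
  have h4 : 0 < ‖fderiv ℝ F η‖ := (inv_pos.2 hR0).trans_le h3
  rw [levelNormalCurvature, le_div_iff₀ (by positivity)] at h1
  rw [← hF.hess_smul (inv_pos.2 hFv) hv, div_eq_inv_mul, mul_assoc]
  gcongr
  calc κ * R⁻¹ * ‖w‖ ^ 2 ≤ κ * ‖fderiv ℝ F η‖ * ‖w‖ ^ 2 := by gcongr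
    _ ≤ _ := by rw [mul_assoc]; exact h1

/-- The tangential part of `w` has the same second derivative as `w`. -/
theorem hess_sub_smul_self (hF : IsAnisotropicIntegrand F) {v : Cotangent n} (hv : v ≠ 0)
    (w : Cotangent n) (s : ℝ) : hess F v (w - s • v) (w - s • v) = hess F v w w := by
  simp [hF.hess_self hv, hF.hess_self_right hv]

theorem fderiv_sub_smul_self (hF : IsAnisotropicIntegrand F) {v : Cotangent n} (hv : v ≠ 0)
    (w : Cotangent n) : fderiv ℝ F v (w - (fderiv ℝ F v w / F v) • v) = 0 := by
  simp [hF.fderiv_self hv, (hF.pos v hv).ne']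

theorem hess_nonneg (hF : IsAnisotropicIntegrand F) {v : Cotangent n} (hv : v ≠ 0)
    (w : Cotangent n) : 0 ≤ hess F v w w := by
  obtain ⟨c, hc, h⟩ := hF.exists_hess_coercive
  rw [← hF.hess_sub_smul_self hv w (fderiv ℝ F v w / F v)]
  have := hF.pos v hv
  exact le_trans (by positivity) (h v hv _ (hF.fderiv_sub_smul_self hv w))

theorem exists_hess_horizontal_coercive (hF : IsAnisotropicIntegrand F)
    (φ : Module.Basis (Fin (n + 1)) ℝ (Cotangent n)) :
    ∃ c > 0, ∀ v ≠ 0, ∀ p : Fin n → ℝ, fderiv ℝ F v (horizontal φ p) = 0 →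
      c / F v * (p ⬝ᵥ p) ≤ hess F v (horizontal φ p) (horizontal φ p) := by
  obtain ⟨c, hc, h⟩ := hF.exists_hess_coercive
  let L : Cotangent n →L[ℝ] (Fin (n + 1) → ℝ) :=
    (φ.equivFun : Cotangent n →ₗ[ℝ] (Fin (n + 1) → ℝ)).toContinuousLinearMap
  have hL (p : Fin n → ℝ) (i : Fin n) : L (horizontal φ p) i.succ = p i := by
    simp [L, horizontal, Finsupp.single_apply]
  -- The factor compares Euclidean coordinates with the norm on V*; the +1 keeps it positive for n =
  -- 0.
  refine ⟨c / (n * ‖L‖ ^ 2 + 1), by positivity, fun v hv p hp => ?_⟩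
  have hFv := hF.pos v hv
  have h1 : p ⬝ᵥ p ≤ (n * ‖L‖ ^ 2 + 1) * ‖horizontal φ p‖ ^ 2 := by
    have h2 (i : Fin n) : p i * p i ≤ (‖L‖ * ‖horizontal φ p‖) ^ 2 := by
      rw [← pow_two, ← sq_abs]
      gcongr
      calc |p i| = ‖L (horizontal φ p) i.succ‖ := by rw [hL]; rfl
        _ ≤ ‖L (horizontal φ p)‖ := norm_le_pi_norm _ _
        _ ≤ _ := L.le_opNorm _
    calc p ⬝ᵥ p ≤ ∑ _i : Fin n, (‖L‖ * ‖horizontal φ p‖) ^ 2 :=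
          Finset.sum_le_sum fun i _ => h2 i
      _ = n * ‖L‖ ^ 2 * ‖horizontal φ p‖ ^ 2 := by simp; ring
      _ ≤ _ := by gcongr; linarith
  calc c / (n * ‖L‖ ^ 2 + 1) / F v * (p ⬝ᵥ p)
      ≤ c / (n * ‖L‖ ^ 2 + 1) / F v * ((n * ‖L‖ ^ 2 + 1) * ‖horizontal φ p‖ ^ 2) := by gcongr
    _ = c / F v * ‖horizontal φ p‖ ^ 2 := by
        have : (n * ‖L‖ ^ 2 + 1) ≠ 0 := by positivity
        field_simp
    _ ≤ _ := h v hv _ hp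

theorem continuousOn_fderiv (hF : IsAnisotropicIntegrand F) (w : Cotangent n) :
    ContinuousOn (fun v => fderiv ℝ F v w) {0}ᶜ := fun v hv =>
  (((hF.contDiffAt v hv).of_le (by norm_num)).hasFDerivAt_fderiv_apply
    w).continuousAt.continuousWithinAt

theorem continuousOn_hess (hF : IsAnisotropicIntegrand F) (w z : Cotangent n) :
    ContinuousOn (fun v => hess F v w z) {0}ᶜ := fun v hv =>
  ((hF.contDiffAt v hv).hasFDerivAt_hess_apply w z).continuousAt.continuousWithinAt

theorem continuousOn_fderiv_hess (hF : IsAnisotropicIntegrand F) (w z y : Cotangent n) :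
    ContinuousOn (fun v => fderiv ℝ (hess F) v w z y) {0}ᶜ := fun v hv =>
  ((hF.contDiffAt v hv).continuousAt_fderiv_hess_apply w z y).continuousWithinAt

variable {φ : Module.Basis (Fin (n + 1)) ℝ (Cotangent n)}

theorem exists_asymptotics_levelSet (hF : IsAnisotropicIntegrand F) (hs : SymmetryCondition φ F)
    {ε : ℝ} (hε : 0 < ε) :
    ∃ δ > 0, ∀ v, F v = 1 → |φ.coord 0 v| ≤ δ →
      |fderiv ℝ F v (φ 0)| ≤ ε ∧
      (∀ i j : Fin n, |fderiv ℝ (hess F) v (φ 0) (φ i.succ) (φ j.succ)| ≤ ε) ∧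
      |fderiv ℝ (hess F) v (φ 0) (φ 0) (φ 0)| ≤ ε := by
  have hsub : {v | F v = 1} ⊆ ({0}ᶜ : Set (Cotangent n)) := fun v hv =>
    hF.ne_zero_of_pos (by rw [show F v = 1 from hv]; exact one_pos)
  have hc : Continuous (φ.coord 0) := LinearMap.continuous_of_finiteDimensional _
  obtain ⟨δ, hδ, h⟩ := hF.isCompact_levelSet.exists_forall_abs_le_of_eq_zero
    -- Bounding the sum of all the absolute values yields a single δ.
    (f := fun v => |fderiv ℝ F v (φ 0)| +
      (∑ i : Fin n, ∑ j : Fin n, |fderiv ℝ (hess F) v (φ 0) (φ i.succ) (φ j.succ)|) +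
      |fderiv ℝ (hess F) v (φ 0) (φ 0) (φ 0)|) (g := φ.coord 0)
    (((hF.continuousOn_fderiv _).abs.add (continuousOn_finsetSum _ fun i _ =>
      continuousOn_finsetSum _ fun j _ => (hF.continuousOn_fderiv_hess _ _ _).abs)).add
      (hF.continuousOn_fderiv_hess _ _ _).abs |>.mono hsub) hc.continuousOn
    (fun v hv h0 => by
      simp [hs.fderiv_eq_zero hF (hsub hv) h0, hs.fderiv_hess_eq_zero hF (hsub hv) h0,
        hs.fderiv_hess_zero_eq_zero hF (hsub hv) h0]) hε
  refine ⟨δ, hδ, fun v hv h0 => ?_⟩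
  have h1 := (le_abs_self _).trans (h v hv h0)
  have h2 : 0 ≤ ∑ i : Fin n, ∑ j : Fin n, |fderiv ℝ (hess F) v (φ 0) (φ i.succ) (φ j.succ)| :=
    Finset.sum_nonneg fun i _ => Finset.sum_nonneg fun j _ => abs_nonneg _
  have h3 := abs_nonneg (fderiv ℝ F v (φ 0))
  have h4 := abs_nonneg (fderiv ℝ (hess F) v (φ 0) (φ 0) (φ 0))
  refine ⟨by linarith, fun i j => ?_, by linarith⟩
  have h5 : |fderiv ℝ (hess F) v (φ 0) (φ i.succ) (φ j.succ)| ≤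
      ∑ i : Fin n, ∑ j : Fin n, |fderiv ℝ (hess F) v (φ 0) (φ i.succ) (φ j.succ)| :=
    (Finset.single_le_sum (f := fun j : Fin n =>
      |fderiv ℝ (hess F) v (φ 0) (φ i.succ) (φ j.succ)|) (fun _ _ => abs_nonneg _)
      (Finset.mem_univ j)).trans (Finset.single_le_sum (f := fun i : Fin n =>
        ∑ j : Fin n, |fderiv ℝ (hess F) v (φ 0) (φ i.succ) (φ j.succ)|)
        (fun _ _ => Finset.sum_nonneg fun _ _ => abs_nonneg _) (Finset.mem_univ i))
  linarith

/-- The point v / F v has φ⁰-coordinate −1 / F v, so large F v puts it near the hyperplane; the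
powers of F v come from the degrees 0, −1, −2 of the derivatives. The constant c0 precedes ε because
ε is later chosen in terms of c0. -/
theorem exists_asymptotics (hF : IsAnisotropicIntegrand F) (hs : SymmetryCondition φ F) :
    ∃ c0 > 0, ∀ ε > 0, ∃ S ≥ 1, ∀ v, φ.coord 0 v = -1 → S ≤ F v →
      |fderiv ℝ F v (φ 0)| ≤ ε ∧
      (∀ i j : Fin n, |fderiv ℝ (hess F) v (φ 0) (φ i.succ) (φ j.succ)| ≤ ε / F v ^ 2) ∧
      |fderiv ℝ (hess F) v (φ 0) (φ 0) (φ 0)| ≤ ε / F v ^ 2 ∧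
      hess F v (φ 0) (φ 0) ≤ ε ∧ c0 ≤ F v * hess F v (φ 0) (φ 0) := by
  obtain ⟨R, hR0, hR⟩ := hF.isCompact_levelSet.isBounded.exists_pos_norm_le
  obtain ⟨c, hc, hcoer⟩ := hF.exists_hess_coercive
  have hsub : {v | F v = 1} ⊆ ({0}ᶜ : Set (Cotangent n)) := fun v hv =>
    hF.ne_zero_of_pos (by rw [show F v = 1 from hv]; exact one_pos)
  obtain ⟨C, hC⟩ := hF.isCompact_levelSet.exists_bound_of_continuousOn
    ((hF.continuousOn_hess (φ 0) (φ 0)).mono hsub)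
  have hφ0 : 0 < ‖φ 0‖ := norm_pos_iff.2 (φ.ne_zero 0)
  -- With this bound on DF(φ⁰), the component of φ⁰ tangent to the level set keeps norm at least
  -- ‖φ⁰‖/2, whence the value of c0.
  obtain ⟨δ1, hδ1, h1⟩ := hF.exists_asymptotics_levelSet hs
    (ε := ‖φ 0‖ / (2 * R)) (by positivity)
  refine ⟨c * (‖φ 0‖ / 2) ^ 2, by positivity, fun ε hε => ?_⟩
  obtain ⟨δ, hδ, h2⟩ := hF.exists_asymptotics_levelSet hs hε
  refine ⟨max 1 (max (max δ1⁻¹ δ⁻¹) (C / ε)), le_max_left _ _, fun v hv0 hv => ?_⟩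
  simp only [max_le_iff] at hv
  obtain ⟨hv1, ⟨hvδ1, hvδ⟩, hvC⟩ := hv
  have hFv : 0 < F v := by linarith
  have hvne := hF.ne_zero_of_pos hFv
  have hη := hF.inv_smul_mem_levelSet hvne
  have hcoord : |φ.coord 0 ((F v)⁻¹ • v)| = (F v)⁻¹ := by
    rw [map_smul, hv0]; simp [abs_of_pos hFv]
  have hi := inv_pos.2 hFv
  obtain ⟨ha, -, -⟩ := h1 _ hη (by rw [hcoord]; exact inv_le_of_inv_le₀ hδ1 hvδ1)
  obtain ⟨hb, hb', hb''⟩ := h2 _ hη (by rw [hcoord]; exact inv_le_of_inv_le₀ hδ hvδ)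
  have hess_eq (w z : Cotangent n) :
      F v * hess F v w z = hess F ((F v)⁻¹ • v) w z := by
    rw [← hF.hess_smul hi hvne, ← mul_assoc, mul_inv_cancel₀ hFv.ne', one_mul]
  have third (w z y : Cotangent n) (h : |fderiv ℝ (hess F) ((F v)⁻¹ • v) w z y| ≤ ε) :
      |fderiv ℝ (hess F) v w z y| ≤ ε / F v ^ 2 := by
    rw [← hF.fderiv_hess_smul hi hvne, abs_mul, abs_of_pos (by positivity), inv_pow, div_eq_inv_mul]
    gcongr
  refine ⟨by rwa [hF.fderiv_smul hi hvne] at hb, fun i j => third _ _ _ (hb' i j),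
    third _ _ _ hb'', ?_, ?_⟩
  · have h3 := (le_abs_self _).trans (hC _ hη)
    rw [← hess_eq] at h3
    rw [div_le_iff₀ hε] at hvC
    nlinarith
  · rw [hess_eq]
    have hη0 : (F v)⁻¹ • v ≠ 0 := hsub hη
    set η := (F v)⁻¹ • v
    have h4 := hcoer η hη0 _ (hF.fderiv_sub_smul_self hη0 (φ 0))
    rw [hF.hess_sub_smul_self hη0, hη, div_one, div_one] at h4
    refine le_trans ?_ h4
    gcongr
    have h5 : ‖fderiv ℝ F η (φ 0) • η‖ ≤ ‖φ 0‖ / 2 := by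
      calc _ = |fderiv ℝ F η (φ 0)| * ‖η‖ := norm_smul _ _
        _ ≤ ‖φ 0‖ / (2 * R) * R := by gcongr; exact hR η hη
        _ = _ := by field_simp
    linarith [norm_sub_norm_le (φ 0) (fderiv ℝ F η (φ 0) • η)]

end IsAnisotropicIntegrand

/-! ### The algebraic inequality for the reaction terms. -/

section Algebra

variable {n : ℕ}

/-- Coercivity is used twice: on the rows of K, orthogonal to ξ as Kξ = 0, and on the vectors K b_l,
orthogonal to ξ as K is symmetric. -/
theorem sum_sum_sq_ge_of_coercive {b : Fin n → Fin n → ℝ} {K : Matrix (Fin n) (Fin n) ℝ}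
    {ξ : Fin n → ℝ} {γ : ℝ} (hγ : 0 ≤ γ) (hK : K.transpose = K) (hKξ : K.mulVec ξ = 0)
    (hb : ∀ ζ : Fin n → ℝ, ζ ⬝ᵥ ξ = 0 → γ * (ζ ⬝ᵥ ζ) ≤ ∑ k, (b k ⬝ᵥ ζ) ^ 2) :
    γ ^ 2 * ∑ i, ∑ j, K i j ^ 2 ≤ ∑ k, ∑ l, (b k ⬝ᵥ K.mulVec (b l)) ^ 2 := by
  have orth (y : Fin n → ℝ) : K.mulVec y ⬝ᵥ ξ = 0 := by
    rw [dotProduct_comm, Matrix.dotProduct_mulVec, ← Matrix.mulVec_transpose, hK, hKξ,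
      zero_dotProduct]
  have h1 (i : Fin n) : γ * ∑ j, K i j ^ 2 ≤ ∑ k, (b k ⬝ᵥ K i) ^ 2 := by
    have h := hb (K i) (by
      have := congrFun hKξ i
      simpa [Matrix.mulVec] using this)
    simpa [dotProduct, pow_two] using h
  have h2 (l : Fin n) : γ * ∑ i, (b l ⬝ᵥ K i) ^ 2 ≤ ∑ k, (b k ⬝ᵥ K.mulVec (b l)) ^ 2 := by
    have h := hb (K.mulVec (b l)) (orth _)
    have e : K.mulVec (b l) ⬝ᵥ K.mulVec (b l) = ∑ i, (b l ⬝ᵥ K i) ^ 2 := by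
      simp only [dotProduct, Matrix.mulVec, pow_two]
      simp [mul_comm]
    rwa [e] at h
  calc γ ^ 2 * ∑ i, ∑ j, K i j ^ 2 = γ * ∑ i, γ * ∑ j, K i j ^ 2 := by
        rw [← Finset.mul_sum]; ring
    _ ≤ γ * ∑ i, ∑ k, (b k ⬝ᵥ K i) ^ 2 := by gcongr with i; exact h1 i
    _ = ∑ l, γ * ∑ i, (b l ⬝ᵥ K i) ^ 2 := by rw [Finset.sum_comm, Finset.mul_sum]
    _ ≤ ∑ l, ∑ k, (b k ⬝ᵥ K.mulVec (b l)) ^ 2 := by gcongr with l; exact h2 l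
    _ = _ := Finset.sum_comm

theorem add_sq_le_of_sq_le {x y α β N : ℝ} (hx : x ^ 2 ≤ α ^ 2 * N) (hy : y ^ 2 ≤ β ^ 2 * N)
    (hα : 0 ≤ α) (hβ : 0 ≤ β) (hN : 0 ≤ N) : (x + y) ^ 2 ≤ (α + β) ^ 2 * N := by
  have h : (x * y) ^ 2 ≤ (α * β * N) ^ 2 := by
    calc (x * y) ^ 2 = x ^ 2 * y ^ 2 := by ring
      _ ≤ (α ^ 2 * N) * (β ^ 2 * N) := by gcongr
      _ = _ := by ring
  nlinarith [(le_abs_self _).trans (abs_le_of_sq_le_sq h (by positivity))]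

/-- Young's inequality absorbs the K-terms in N2/2 at cost c²D²/2 ≤ c²θ/16, where θ = r g0. The
dominant term is −2ρθc² with ρ = r/(r + a) near 1; every error is a small multiple of θc², so −3/2
survives. -/
theorem scalar_reaction_le {r c a g0 m0 ε c0 D GK MK N2 κ : ℝ}
    (hr : 1 ≤ r) (hc0 : 0 < c0) (ha : |a| ≤ ε) (hm0 : |m0| ≤ ε / r ^ 2) (hg0 : g0 ≤ ε)
    (hθ : c0 ≤ r * g0) (hε : ε ≤ 1 / 16) (hεc : ε ≤ c0 / 16) (hD : D ^ 2 ≤ c0 / 8)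
    (hκ : κ = r * c / (r + a)) (hN2 : 0 ≤ N2)
    (hGM : (a * GK + r * MK) ^ 2 ≤ D ^ 2 * N2) :
    c * (a * (GK + κ * g0) + r * (MK + κ * (m0 - 2 * g0))) - (N2 / 2 - κ ^ 2 * g0 ^ 2) ≤
      -(3 / 2) * c ^ 2 * (r * g0) := by
  have hε0 : 0 ≤ ε := (abs_nonneg a).trans ha
  obtain ⟨ha1, ha2⟩ := abs_le.1 ha
  have hra : 0 < r + a := by linarith
  set ρ := r / (r + a) with hρ
  have hκ' : κ = ρ * c := by rw [hκ, hρ]; ring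
  have hρ1 : 16 / 17 ≤ ρ := by rw [hρ, le_div_iff₀ hra]; linarith
  have hρ2 : ρ ≤ 16 / 15 := by rw [hρ, div_le_iff₀ hra]; linarith
  set θ := r * g0 with hθd
  have hg0p : 0 < g0 := by
    by_contra h
    push Not at h
    nlinarith
  have hgθ : g0 ≤ θ := by nlinarith
  have h1 : c * (a * GK + r * MK) ≤ N2 / 2 + c ^ 2 * D ^ 2 / 2 := by
    have h0 : (2 * (c * (a * GK + r * MK))) ^ 2 ≤ (N2 + c ^ 2 * D ^ 2) ^ 2 := by
      nlinarith [mul_le_mul_of_nonneg_left hGM (sq_nonneg c), sq_nonneg (N2 - c ^ 2 * D ^ 2)]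
    linarith [(le_abs_self _).trans (abs_le_of_sq_le_sq h0 (by positivity))]
  have h2 : a * g0 ≤ θ / 16 := by nlinarith
  have h3 : r * m0 ≤ θ / 16 := by
    have : r * |m0| ≤ ε := by
      calc r * |m0| ≤ r * (ε / r ^ 2) := by gcongr
        _ = ε / r := by field_simp
        _ ≤ ε := div_le_self hε0 hr
    nlinarith [le_abs_self m0]
  have h4 : g0 ^ 2 ≤ θ / 16 := by nlinarith
  have h5 : ρ * (a * g0 + r * m0 - 2 * θ) ≤ - (30 / 17) * θ := by nlinarith
  have h6 : ρ ^ 2 * g0 ^ 2 ≤ (16 / 15) ^ 2 * (θ / 16) := by gcongr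
  have h7 : ρ * (a * g0 + r * m0 - 2 * θ) + ρ ^ 2 * g0 ^ 2 + D ^ 2 / 2 ≤ -(3 / 2) * θ := by
    linarith
  have h8 := mul_le_mul_of_nonneg_left h7 (sq_nonneg c)
  rw [hκ']
  nlinarith

/-- The reaction terms in the evolution of the area density have the good sign. The point is that
`H` agrees with a multiple of `p ⊗ p` up to a tensor annihilated by `ξ`, on which the form
`∑ bₖ ⊗ bₖ` is coercive. -/
theorem reaction_le {b : Fin n → Fin n → ℝ} {H M : Matrix (Fin n) (Fin n) ℝ}
    {p ξ : Fin n → ℝ} {r c a g0 m0 ε c0 c1 : ℝ} (hH : H.transpose = H)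
    (hξp : ξ ⬝ᵥ p = r + a) (hHξ : H.mulVec ξ = (r * c) • p)
    (hg : ∑ k, (b k ⬝ᵥ p) ^ 2 = g0) (hM : ∑ i, ∑ j, M i j * (p i * p j) = m0 - 2 * g0)
    (hMij : ∀ i j, |M i j| ≤ ε / r ^ 2)
    (hb : ∀ ζ : Fin n → ℝ, ζ ⬝ᵥ ξ = 0 → c1 / r * (ζ ⬝ᵥ ζ) ≤ ∑ k, (b k ⬝ᵥ ζ) ^ 2)
    (hr : 1 ≤ r) (hc0 : 0 < c0) (hc1 : 0 < c1) (ha : |a| ≤ ε) (hm0 : |m0| ≤ ε / r ^ 2)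
    (hg0 : g0 ≤ ε) (hθ : c0 ≤ r * g0) (hε : ε ≤ 1 / 16) (hεc : ε ≤ c0 / 16)
    (hD : (ε * n * (1 + 1 / c1)) ^ 2 ≤ c0 / 8) :
    c * (a * ∑ k, b k ⬝ᵥ H.mulVec (b k) + r * ∑ i, ∑ j, M i j * H i j)
      - ∑ k, ∑ l, (b k ⬝ᵥ H.mulVec (b l)) ^ 2 ≤ -(3 / 2) * c ^ 2 * (r * g0) := by
  obtain ⟨ha1, ha2⟩ := abs_le.1 ha
  have hε0 : 0 ≤ ε := (abs_nonneg a).trans ha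
  have hra : 0 < r + a := by linarith
  -- This κ makes (H − κ p ⊗ p)ξ = (rc − κ(r + a))p vanish.
  set κ := r * c / (r + a) with hκ
  set K : Matrix (Fin n) (Fin n) ℝ := H - κ • Matrix.vecMulVec p p with hKdef
  have hKH (x y : Fin n → ℝ) :
      x ⬝ᵥ H.mulVec y = x ⬝ᵥ K.mulVec y + κ * ((x ⬝ᵥ p) * (y ⬝ᵥ p)) := by
    simp [hKdef, Matrix.sub_mulVec, Matrix.smul_mulVec, Matrix.vecMulVec_mulVec,
      dotProduct_comm p y]
    ring
  have hKt : K.transpose = K := by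
    simp [hKdef, hH, Matrix.transpose_vecMulVec]
  have hKξ : K.mulVec ξ = 0 := by
    simp only [hKdef, Matrix.sub_mulVec, Matrix.smul_mulVec, Matrix.vecMulVec_mulVec, hHξ,
      dotProduct_comm p ξ, hξp]
    ext i
    simp [hκ]
    field_simp
    ring
  set N2 := ∑ k, ∑ l, (b k ⬝ᵥ K.mulVec (b l)) ^ 2 with hN2
  have hN2H : N2 / 2 - κ ^ 2 * g0 ^ 2 ≤ ∑ k, ∑ l, (b k ⬝ᵥ H.mulVec (b l)) ^ 2 := by
    have e : g0 ^ 2 = ∑ k, ∑ l, ((b k ⬝ᵥ p) * (b l ⬝ᵥ p)) ^ 2 := by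
      simp_rw [mul_pow]
      rw [← Finset.sum_mul_sum, hg, pow_two]
    rw [e, hN2, Finset.sum_div, Finset.mul_sum, ← Finset.sum_sub_distrib]
    refine Finset.sum_le_sum fun k _ => ?_
    rw [Finset.sum_div, Finset.mul_sum, ← Finset.sum_sub_distrib]
    refine Finset.sum_le_sum fun l _ => ?_
    rw [hKH]
    -- This is (x + y)² ≥ x²/2 − y², the difference being (x + 2y)²/2.
    nlinarith [sq_nonneg (b k ⬝ᵥ K.mulVec (b l) + 2 * (κ * ((b k ⬝ᵥ p) * (b l ⬝ᵥ p))))]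
  set GK := ∑ k, b k ⬝ᵥ K.mulVec (b k) with hGK
  set MK := ∑ i, ∑ j, M i j * K i j with hMK
  have hGKN : GK ^ 2 ≤ n ^ 2 * N2 := by
    have h1 : GK ^ 2 ≤ n * ∑ k, (b k ⬝ᵥ K.mulVec (b k)) ^ 2 := by
      simpa using sq_sum_le_card_mul_sum_sq (s := Finset.univ)
        (f := fun k => b k ⬝ᵥ K.mulVec (b k))
    have h2 : ∑ k, (b k ⬝ᵥ K.mulVec (b k)) ^ 2 ≤ N2 := Finset.sum_le_sum fun k _ =>
      Finset.single_le_sum (f := fun l => (b k ⬝ᵥ K.mulVec (b l)) ^ 2)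
        (fun l _ => sq_nonneg _) (Finset.mem_univ k)
    have h3 : (n : ℝ) ≤ n ^ 2 := by exact_mod_cast Nat.le_self_pow two_ne_zero n
    have h4 : 0 ≤ N2 := Finset.sum_nonneg fun k _ => Finset.sum_nonneg fun l _ => sq_nonneg _
    calc GK ^ 2 ≤ n * N2 := h1.trans (by gcongr)
      _ ≤ n ^ 2 * N2 := by gcongr
  have hMKN : (r * MK) ^ 2 ≤ (ε * n / c1) ^ 2 * N2 := by
    have h1 := sum_sum_sq_ge_of_coercive (γ := c1 / r) (by positivity) hKt hKξ hb
    rw [← hN2] at h1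
    have h2 : MK ^ 2 ≤ (∑ x : Fin n × Fin n, M x.1 x.2 ^ 2) * ∑ x : Fin n × Fin n, K x.1 x.2 ^ 2 := by
      rw [hMK, ← Fintype.sum_prod_type' (f := fun i j => M i j * K i j)]
      exact Finset.sum_mul_sq_le_sq_mul_sq _ _ _
    have h3 : ∑ x : Fin n × Fin n, M x.1 x.2 ^ 2 ≤ n ^ 2 * (ε / r ^ 2) ^ 2 := by
      calc _ ≤ ∑ x : Fin n × Fin n, (ε / r ^ 2) ^ 2 := Finset.sum_le_sum fun x _ =>
            sq_le_sq' (by linarith [(abs_le.1 (hMij x.1 x.2)).1]) (abs_le.1 (hMij x.1 x.2)).2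
        _ = _ := by simp [pow_two]
    rw [Fintype.sum_prod_type' (f := fun i j => K i j ^ 2)] at h2
    set K2 := ∑ i, ∑ j, K i j ^ 2
    have hK2 : 0 ≤ K2 := Finset.sum_nonneg fun k _ => Finset.sum_nonneg fun l _ => sq_nonneg _
    have h4 := h2.trans (mul_le_mul_of_nonneg_right h3 hK2)
    -- The powers of r cancel: the factor r, the bound ε/r² on M, and the loss r/c1 from coercivity.
    have e (x : ℝ) : r ^ 2 * (n ^ 2 * (ε / r ^ 2) ^ 2 * x) =
        (ε * n / c1) ^ 2 * ((c1 / r) ^ 2 * x) := by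
      have : r ≠ 0 := by positivity
      field_simp
    rw [mul_pow]
    refine (mul_le_mul_of_nonneg_left h4 (sq_nonneg r)).trans ?_
    rw [e]
    exact mul_le_mul_of_nonneg_left h1 (sq_nonneg _)
  have hGM : (a * GK + r * MK) ^ 2 ≤ (ε * n * (1 + 1 / c1)) ^ 2 * N2 := by
    have h4 : 0 ≤ N2 := Finset.sum_nonneg fun k _ => Finset.sum_nonneg fun l _ => sq_nonneg _
    have h5 : (a * GK) ^ 2 ≤ (ε * n) ^ 2 * N2 := by
      calc (a * GK) ^ 2 = a ^ 2 * GK ^ 2 := by ring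
        _ ≤ ε ^ 2 * (n ^ 2 * N2) := by
          gcongr ?_ * ?_
          exact sq_le_sq' ha1 ha2
        _ = _ := by ring
    have h6 := add_sq_le_of_sq_le h5 hMKN (by positivity) (by positivity) h4
    convert h6 using 2
    ring
  have hGH : ∑ k, b k ⬝ᵥ H.mulVec (b k) = GK + κ * g0 := by
    rw [hGK, ← hg, Finset.mul_sum, ← Finset.sum_add_distrib]
    exact Finset.sum_congr rfl fun k _ => by rw [hKH]; ring
  have hMH : ∑ i, ∑ j, M i j * H i j = MK + κ * (m0 - 2 * g0) := by
    rw [hMK, ← hM, Finset.mul_sum, ← Finset.sum_add_distrib]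
    refine Finset.sum_congr rfl fun i _ => ?_
    rw [Finset.mul_sum, ← Finset.sum_add_distrib]
    refine Finset.sum_congr rfl fun j _ => ?_
    simp [hKdef, Matrix.vecMulVec_apply]
    ring
  rw [hGH, hMH]
  linarith [scalar_reaction_le hr hc0 ha hm0 hg0 hθ hε hεc hD hκ
    (Finset.sum_nonneg fun k _ => Finset.sum_nonneg fun l _ => sq_nonneg _) hGM]

end Algebra

/-! ### Derivative tests along lines for F(ν) − g(f), and the derivative of the speed. -/

section Calculus

/-- If c > 0, the point would also be a local minimum, so y would be locally constant and c = 0. -/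
theorem le_zero_of_isLocalMax_of_hasDerivAt {y y' : ℝ → ℝ} {c s : ℝ} (hmax : IsLocalMax y s)
    (hy : ∀ t, HasDerivAt y (y' t) t) (hy' : HasDerivAt y' c s) : c ≤ 0 := by
  by_contra hc
  push Not at hc
  have e : deriv y = y' := funext fun t => (hy t).deriv
  have hmin : IsLocalMin y s := isLocalMin_of_deriv_deriv_pos (by rw [e, hy'.deriv]; exact hc)
    hmax.deriv_eq_zero (hy s).continuousAt
  have h1 : y =ᶠ[nhds s] fun _ => y s := by
    filter_upwards [hmax, hmin] with t h1 h2
    exact le_antisymm h1 h2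
  have h2 : deriv y =ᶠ[nhds s] fun _ => 0 := by
    filter_upwards [h1.eventually_nhds] with t ht
    have := Filter.EventuallyEq.deriv_eq ht
    rw [this, deriv_const]
  have h3 : deriv (deriv y) s = 0 := by
    rw [h2.deriv_eq, deriv_const]
  rw [e, hy'.deriv] at h3
  linarith

section Line

variable {E : Type*} [NormedAddCommGroup E] [NormedSpace ℝ E] {f : E → ℝ}

theorem hasDerivAt_add_smul (x b : E) (s : ℝ) : HasDerivAt (fun s : ℝ => x + s • b) b s := by
  simpa using ((hasDerivAt_id s).smul_const b).const_add x

theorem hasDerivAt_line (hf : ContDiff ℝ 3 f) (x b : E) (s : ℝ) :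
    HasDerivAt (fun s : ℝ => f (x + s • b)) (fderiv ℝ f (x + s • b) b) s :=
  (hf.differentiable (by norm_num) _).hasFDerivAt.comp_hasDerivAt s (hasDerivAt_add_smul x b s)

theorem hasDerivAt_fderiv_line (hf : ContDiff ℝ 3 f) (x b : E) (s : ℝ) :
    HasDerivAt (fun s : ℝ => fderiv ℝ f (x + s • b)) (hess f (x + s • b) b) s := by
  have h1 : HasFDerivAt (fderiv ℝ f) (hess f (x + s • b)) (x + s • b) :=
    ((hf.fderiv_right (m := 2) (by norm_num)).differentiable (by norm_num) _).hasFDerivAt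
  exact h1.comp_hasDerivAt s (hasDerivAt_add_smul x b s)

set_option maxSynthPendingDepth 5 in
theorem hasDerivAt_hess_line (hf : ContDiff ℝ 3 f) (x b w : E) (s : ℝ) :
    HasDerivAt (fun s : ℝ => hess f (x + s • b) w)
      (fderiv ℝ (hess f) (x + s • b) b w) s := by
  have h1 : HasFDerivAt (hess f) (fderiv ℝ (hess f) (x + s • b)) (x + s • b) :=
    (((hf.fderiv_right (m := 2) (by norm_num)).fderiv_right (m := 1) (by norm_num)).differentiable
      (by norm_num) _).hasFDerivAt
  have h2 := h1.comp_hasDerivAt s (hasDerivAt_add_smul x b s)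
  simpa using h2.clm_apply (hasDerivAt_const s w)

theorem isLocalMax_line {Y : E → ℝ} {x : E} (h : IsLocalMax Y x) (b : E) :
    IsLocalMax (fun s : ℝ => Y (x + s • b)) 0 := by
  have hc : ContinuousAt (fun s : ℝ => x + s • b) 0 := by fun_prop
  have h' : IsLocalMax Y (x + (0 : ℝ) • b) := by simpa using h
  exact IsLocalMax.comp_continuous (g := fun s : ℝ => x + s • b) h' hc

end Line

variable {n : ℕ} (φ : Module.Basis (Fin (n + 1)) ℝ (Cotangent n))

/-- `ℓ ↦ ∑ ℓ(eᵢ) φⁱ` -/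
noncomputable def horizontalLift :
    (EuclideanSpace ℝ (Fin n) →L[ℝ] ℝ) →L[ℝ] Cotangent n :=
  ∑ i, (ContinuousLinearMap.apply ℝ ℝ (stdVec i)).smulRight (φ i.succ)

theorem horizontalLift_apply (ℓ : EuclideanSpace ℝ (Fin n) →L[ℝ] ℝ) :
    horizontalLift φ ℓ = horizontal φ (fun i => ℓ (stdVec i)) := by
  simp [horizontalLift, horizontal]

theorem conormal_eq (f : EuclideanSpace ℝ (Fin n) → ℝ) (x : EuclideanSpace ℝ (Fin n)) :
    conormal φ f x = horizontalLift φ (fderiv ℝ f x) - φ 0 := by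
  rw [horizontalLift_apply]; rfl

theorem coord_zero_horizontal (p : Fin n → ℝ) : φ.coord 0 (horizontal φ p) = 0 := by
  simp [horizontal]

theorem coord_zero_conormal (f : EuclideanSpace ℝ (Fin n) → ℝ) (x : EuclideanSpace ℝ (Fin n)) :
    φ.coord 0 (conormal φ f x) = -1 := by
  rw [conormal_eq, horizontalLift_apply, map_sub, coord_zero_horizontal]
  simp

theorem conormal_ne_zero (f : EuclideanSpace ℝ (Fin n) → ℝ) (x : EuclideanSpace ℝ (Fin n)) :
    conormal φ f x ≠ 0 := by
  intro h
  have := coord_zero_conormal φ f x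
  rw [h, map_zero] at this
  norm_num at this

variable {f : EuclideanSpace ℝ (Fin n) → ℝ}

theorem hasDerivAt_conormal_line (hf : ContDiff ℝ 3 f) (x b : EuclideanSpace ℝ (Fin n)) (s : ℝ) :
    HasDerivAt (fun s : ℝ => conormal φ f (x + s • b))
      (horizontalLift φ (hess f (x + s • b) b)) s := by
  simp_rw [conormal_eq]
  exact ((horizontalLift φ).hasFDerivAt.comp_hasDerivAt s
    (hasDerivAt_fderiv_line hf x b s)).sub_const (φ 0)

variable {F : Cotangent n → ℝ} {g g1 : ℝ → ℝ} {g2 : ℝ} {x : EuclideanSpace ℝ (Fin n)}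

theorem hasDerivAt_density_line (hF : IsAnisotropicIntegrand F) (hf : ContDiff ℝ 3 f)
    (b : EuclideanSpace ℝ (Fin n)) (s : ℝ) :
    HasDerivAt (fun s : ℝ => F (conormal φ f (x + s • b)))
      (fderiv ℝ F (conormal φ f (x + s • b)) (horizontalLift φ (hess f (x + s • b) b))) s :=
  ((hF.contDiffAt _ (conormal_ne_zero φ f _)).differentiableAt
    (by norm_num)).hasFDerivAt.comp_hasDerivAt s (hasDerivAt_conormal_line φ hf x b s)

theorem fderiv_eq_at_max (hF : IsAnisotropicIntegrand F) (hf : ContDiff ℝ 3 f)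
    (hg : ∀ s, HasDerivAt g (g1 s) s)
    (hmax : IsLocalMax (fun y => F (conormal φ f y) - g (f y)) x)
    (b : EuclideanSpace ℝ (Fin n)) :
    fderiv ℝ F (conormal φ f x) (horizontalLift φ (hess f x b)) = g1 (f x) * fderiv ℝ f x b := by
  have h1 := (hasDerivAt_density_line φ (x := x) hF hf b 0).sub
    ((hg _).comp (0 : ℝ) (hasDerivAt_line hf x b 0))
  have := (isLocalMax_line hmax b).hasDerivAt_eq_zero h1
  simp only [zero_smul, add_zero] at this
  linarith

theorem second_deriv_le_at_max (hF : IsAnisotropicIntegrand F) (hf : ContDiff ℝ 3 f)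
    (hg : ∀ s, HasDerivAt g (g1 s) s) (hg1 : HasDerivAt g1 g2 (f x))
    (hmax : IsLocalMax (fun y => F (conormal φ f y) - g (f y)) x)
    (b : EuclideanSpace ℝ (Fin n)) :
    hess F (conormal φ f x) (horizontalLift φ (hess f x b)) (horizontalLift φ (hess f x b)) +
      fderiv ℝ F (conormal φ f x) (horizontalLift φ (fderiv ℝ (hess f) x b b)) -
      (g2 * fderiv ℝ f x b ^ 2 + g1 (f x) * hess f x b b) ≤ 0 := by
  have h1 (s : ℝ) := (hasDerivAt_density_line φ (x := x) hF hf b s).sub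
    ((hg _).comp s (hasDerivAt_line hf x b s))
  refine le_zero_of_isLocalMax_of_hasDerivAt (isLocalMax_line hmax b) h1 ?_
  have hDF : HasFDerivAt (fderiv ℝ F) (hess F (conormal φ f (x + (0 : ℝ) • b)))
      (conormal φ f (x + (0 : ℝ) • b)) :=
    (((hF.contDiffAt _ (conormal_ne_zero φ f _)).fderiv_right (m := 2)
      (by norm_num)).differentiableAt (by norm_num)).hasFDerivAt
  have h2 : HasDerivAt (fun s : ℝ => fderiv ℝ F (conormal φ f (x + s • b)))
      (hess F (conormal φ f (x + (0 : ℝ) • b)) (horizontalLift φ (hess f (x + (0 : ℝ) • b) b))) 0 :=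
    hDF.comp_hasDerivAt (0 : ℝ) (hasDerivAt_conormal_line φ hf x b 0)
  have h3 : HasDerivAt (fun s : ℝ => horizontalLift φ (hess f (x + s • b) b))
      (horizontalLift φ (fderiv ℝ (hess f) (x + (0 : ℝ) • b) b b)) 0 :=
    (horizontalLift φ).hasFDerivAt.comp_hasDerivAt (0 : ℝ) (hasDerivAt_hess_line hf x b b 0)
  have h4 : HasDerivAt (fun s : ℝ => g1 (f (x + s • b))) (g2 * fderiv ℝ f (x + (0 : ℝ) • b) b) 0 := by
    have : HasDerivAt g1 g2 (f (x + (0 : ℝ) • b)) := by simpa using hg1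
    exact this.comp (0 : ℝ) (hasDerivAt_line hf x b 0)
  have h5 : HasDerivAt (fun s : ℝ => fderiv ℝ f (x + s • b) b)
      (hess f (x + (0 : ℝ) • b) b b) 0 := by
    simpa using (hasDerivAt_fderiv_line hf x b 0).clm_apply (hasDerivAt_const (0 : ℝ) b)
  have h6 := (h2.clm_apply h3).sub (h4.mul h5)
  refine HasDerivAt.congr_deriv h6 ?_
  simp only [zero_smul, add_zero]
  ring

theorem hasDerivAt_speed_line (hF : IsAnisotropicIntegrand F) (hf : ContDiff ℝ 3 f)
    (b : EuclideanSpace ℝ (Fin n)) :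
    HasDerivAt (fun s : ℝ => anisotropicSpeed φ F f (x + s • b))
      (∑ i : Fin n, ∑ j : Fin n,
        ((fderiv ℝ F (conormal φ f x) (horizontalLift φ (hess f x b)) *
            hess F (conormal φ f x) (φ i.succ) (φ j.succ) +
          F (conormal φ f x) * fderiv ℝ (hess F) (conormal φ f x)
            (horizontalLift φ (hess f x b)) (φ i.succ) (φ j.succ)) *
            hess f x (stdVec i) (stdVec j) +
          F (conormal φ f x) * hess F (conormal φ f x) (φ i.succ) (φ j.succ) *
            fderiv ℝ (hess f) x b (stdVec i) (stdVec j))) 0 := by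
  unfold anisotropicSpeed
  refine HasDerivAt.fun_sum fun i _ => HasDerivAt.fun_sum fun j _ => ?_
  have h1 := hasDerivAt_density_line φ (x := x) hF hf b 0
  have h2 := ((hF.contDiffAt _ (conormal_ne_zero φ f
    (x + (0 : ℝ) • b))).hasFDerivAt_hess_apply (φ i.succ) (φ j.succ)).comp_hasDerivAt (0 : ℝ)
      (hasDerivAt_conormal_line φ hf x b 0)
  have h3 := (hasDerivAt_hess_line hf x b (stdVec i) 0).clm_apply
    (hasDerivAt_const (0 : ℝ) (stdVec j))
  refine HasDerivAt.congr_deriv ((h1.mul h2).mul h3) ?_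
  simp

end Calculus

/-! ### The differential inequality at a spatial maximum. -/

section SpatialInequality

/-- Writing G as a sum of squares b_k ⊗ b_k reduces a trace against G to tests along the single
directions b_k. -/
theorem exists_sum_mul_eq_of_posSemidef {n : ℕ} {G : Matrix (Fin n) (Fin n) ℝ}
    (hG : G.PosSemidef) : ∃ b : Fin n → Fin n → ℝ, ∀ i j, G i j = ∑ k, b k i * b k j := by
  open scoped MatrixOrder in
  obtain ⟨B, hB⟩ := CStarAlgebra.nonneg_iff_eq_star_mul_self.mp hG.nonneg
  exact ⟨B, fun i j => by simp [hB, Matrix.mul_apply, Matrix.star_apply]⟩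

variable {n : ℕ} (φ : Module.Basis (Fin (n + 1)) ℝ (Cotangent n))

theorem apply_horizontal (A : Cotangent n →L[ℝ] ℝ) (p : Fin n → ℝ) :
    A (horizontal φ p) = (fun i => A (φ i.succ)) ⬝ᵥ p := by
  simp [horizontal, dotProduct, mul_comm]

theorem bilin_horizontal (A : Cotangent n →L[ℝ] Cotangent n →L[ℝ] ℝ) (p q : Fin n → ℝ) :
    A (horizontal φ p) (horizontal φ q) =
      ∑ i, ∑ j, A (φ i.succ) (φ j.succ) * (p i * q j) := by
  simp only [horizontal, map_sum, map_smul, FunLike.coe_sum, Finset.sum_apply,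
    FunLike.coe_smul, Pi.smul_apply, smul_eq_mul, Finset.mul_sum]
  rw [Finset.sum_comm]
  exact Finset.sum_congr rfl fun i _ => Finset.sum_congr rfl fun j _ => by ring

/-- The vector of `ℝⁿ` with coordinates `x`. -/
noncomputable def vecOf (x : Fin n → ℝ) : EuclideanSpace ℝ (Fin n) := ∑ i, x i • stdVec i

theorem apply_vecOf (A : EuclideanSpace ℝ (Fin n) →L[ℝ] ℝ) (x : Fin n → ℝ) :
    A (vecOf x) = (fun i => A (stdVec i)) ⬝ᵥ x := by
  simp [vecOf, dotProduct, mul_comm]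

theorem bilin_vecOf (A : EuclideanSpace ℝ (Fin n) →L[ℝ] EuclideanSpace ℝ (Fin n) →L[ℝ] ℝ)
    (p q : Fin n → ℝ) :
    A (vecOf p) (vecOf q) = ∑ i, ∑ j, A (stdVec i) (stdVec j) * (p i * q j) := by
  simp only [vecOf, map_sum, map_smul, FunLike.coe_sum, Finset.sum_apply,
    FunLike.coe_smul, Pi.smul_apply, smul_eq_mul, Finset.mul_sum]
  rw [Finset.sum_comm]
  exact Finset.sum_congr rfl fun i _ => Finset.sum_congr rfl fun j _ => by ring

theorem sum_sum_mul_eq {b : Fin n → Fin n → ℝ} {G : Fin n → Fin n → ℝ}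
    (hb : ∀ i j, G i j = ∑ k, b k i * b k j) (A : Fin n → Fin n → ℝ) :
    ∑ i, ∑ j, G i j * A i j = ∑ k, ∑ i, ∑ j, A i j * (b k i * b k j) := by
  simp_rw [hb, Finset.sum_mul]
  rw [Finset.sum_comm (s := Finset.univ (α := Fin n)) (t := Finset.univ (α := Fin n))
    (f := fun k i => ∑ j, A i j * (b k i * b k j))]
  refine Finset.sum_congr rfl fun i _ => ?_
  rw [Finset.sum_comm]
  exact Finset.sum_congr rfl fun k _ => Finset.sum_congr rfl fun j _ => mul_comm _ _

theorem sum_sum_mul_eq_sum_dotProduct {b : Fin n → Fin n → ℝ} {G : Fin n → Fin n → ℝ}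
    (hb : ∀ i j, G i j = ∑ k, b k i * b k j) (y z : Fin n → ℝ) :
    ∑ i, ∑ j, G i j * (y i * z j) = ∑ k, (b k ⬝ᵥ y) * (b k ⬝ᵥ z) := by
  rw [sum_sum_mul_eq hb]
  refine Finset.sum_congr rfl fun k _ => ?_
  simp only [dotProduct, Finset.sum_mul_sum]
  exact Finset.sum_congr rfl fun i _ => Finset.sum_congr rfl fun j _ => by ring

theorem dotProduct_mulVec_eq_sum (H : Matrix (Fin n) (Fin n) ℝ) (y z : Fin n → ℝ) :
    y ⬝ᵥ H.mulVec z = ∑ i, ∑ j, H i j * (y i * z j) := by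
  simp only [dotProduct, Matrix.mulVec, Finset.mul_sum]
  exact Finset.sum_congr rfl fun i _ => Finset.sum_congr rfl fun j _ => by ring

variable {φ}

/-- At a spatial maximum of `F(ν) - g(f)`, the derivative of the speed in the direction
`∑ DF|_ν(φⁱ) eᵢ` is controlled. -/
theorem exists_speed_deriv_le {F : Cotangent n → ℝ} (hF : IsAnisotropicIntegrand F)
    (hs : SymmetryCondition φ F) :
    ∃ c0 > 0, ∃ S > 0, ∀ (f : EuclideanSpace ℝ (Fin n) → ℝ) (g g1 : ℝ → ℝ) (g2 : ℝ)
      (x : EuclideanSpace ℝ (Fin n)), ContDiff ℝ 3 f → (∀ s, HasDerivAt g (g1 s) s) →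
      HasDerivAt g1 g2 (f x) → IsLocalMax (fun y => F (conormal φ f y) - g (f y)) x →
      S ≤ F (conormal φ f x) →
      ∃ d θ, c0 ≤ θ ∧ HasDerivAt (fun s : ℝ => anisotropicSpeed φ F f
        (x + s • vecOf (fun i => fderiv ℝ F (conormal φ f x) (φ i.succ)))) d 0 ∧
        d - g1 (f x) * anisotropicSpeed φ F f x ≤
          θ * (g2 - 3 / 2 * g1 (f x) ^ 2 / F (conormal φ f x)) := by
  obtain ⟨c0, hc0, hasym⟩ := hF.exists_asymptotics hs
  obtain ⟨c1, hc1, hcoer⟩ := hF.exists_hess_horizontal_coercive φ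
  obtain ⟨ε, hε, hε1, hεc, hD⟩ : ∃ ε > 0, ε ≤ 1 / 16 ∧ ε ≤ c0 / 16 ∧
      (ε * n * (1 + 1 / c1)) ^ 2 ≤ c0 / 8 := by
    set k : ℝ := n * (1 + 1 / c1) with hk
    have hk0 : 0 ≤ k := by positivity
    -- The smallness that `reaction_le` asks for; k + 1 replaces k since k = 0 when n = 0.
    refine ⟨min (min (1 / 16) (c0 / 16)) (√(c0 / 8) / (k + 1)), by positivity,
      (min_le_left _ _).trans (min_le_left _ _), (min_le_left _ _).trans (min_le_right _ _), ?_⟩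
    set ε := min (min (1 / 16) (c0 / 16)) (√(c0 / 8) / (k + 1))
    have h1 : 0 ≤ ε := by positivity
    have h2 : ε * n * (1 + 1 / c1) ≤ √(c0 / 8) := by
      calc ε * n * (1 + 1 / c1) = ε * k := by rw [hk]; ring
        _ ≤ √(c0 / 8) / (k + 1) * (k + 1) := by gcongr; exacts [min_le_right _ _, by linarith]
        _ = _ := by field_simp
    calc _ ≤ √(c0 / 8) ^ 2 := by gcongr
      _ = _ := Real.sq_sqrt (by positivity)
  obtain ⟨S, hS1, hS⟩ := hasym ε hε
  refine ⟨c0, hc0, S, by linarith, fun f g g1 g2 x hf hg hg1 hmax hSx => ?_⟩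
  have hν := conormal_ne_zero φ f x
  have hν0 := coord_zero_conormal φ f x
  have hcrit := fderiv_eq_at_max φ hF hf hg hmax
  have hsec := second_deriv_le_at_max φ hF hf hg hg1 hmax
  have hpν : horizontal φ (fun i => fderiv ℝ f x (stdVec i)) = conormal φ f x + φ 0 := by
    simp [conormal, horizontal]
  have hspeed : anisotropicSpeed φ F f x = F (conormal φ f x) * ∑ i, ∑ j,
      hess F (conormal φ f x) (φ i.succ) (φ j.succ) * hess f x (stdVec i) (stdVec j) := by
    simp only [anisotropicSpeed, Finset.mul_sum, mul_assoc]
  set ν := conormal φ f x with hνd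
  obtain ⟨ha, hMij, hm0, hg0, hθ⟩ := hS ν hν0 hSx
  set ξ : Fin n → ℝ := fun i => fderiv ℝ F ν (φ i.succ) with hξ
  have hd := hasDerivAt_speed_line φ (x := x) hF hf (vecOf ξ)
  rw [← hνd] at hd
  refine ⟨_, F ν * hess F ν (φ 0) (φ 0), hθ, hd, ?_⟩
  rw [hspeed]
  clear hd hspeed
  set r := F ν with hr
  have hr1 : 1 ≤ r := hS1.trans hSx
  have hr0 : 0 < r := by linarith
  set p : Fin n → ℝ := fun i => fderiv ℝ f x (stdVec i) with hp
  set H : Matrix (Fin n) (Fin n) ℝ := fun i j => hess f x (stdVec i) (stdVec j) with hHd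
  set M : Matrix (Fin n) (Fin n) ℝ :=
    fun i j => fderiv ℝ (hess F) ν (φ 0) (φ i.succ) (φ j.succ) with hMd
  set G : Matrix (Fin n) (Fin n) ℝ := fun i j => hess F ν (φ i.succ) (φ j.succ) with hGd
  have hf2 : ContDiffAt ℝ 2 f x := hf.contDiffAt.of_le (by norm_num)
  have hF2 : ContDiffAt ℝ 2 F ν := (hF.contDiffAt ν hν).of_le (by norm_num)
  have hHt : H.transpose = H := by
    ext i j; exact hess_symm hf2 _ _
  have hG : G.PosSemidef := by
    refine Matrix.PosSemidef.of_dotProduct_mulVec_nonneg ?_ fun y => ?_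
    · ext i j; exact hess_symm hF2 _ _
    · have := hF.hess_nonneg hν (horizontal φ y)
      rw [bilin_horizontal] at this
      rw [dotProduct_mulVec_eq_sum]
      simpa using this
  obtain ⟨b, hb⟩ := exists_sum_mul_eq_of_posSemidef hG
  have hhess (y z : Fin n → ℝ) :
      hess F ν (horizontal φ y) (horizontal φ z) = ∑ k, (b k ⬝ᵥ y) * (b k ⬝ᵥ z) := by
    rw [bilin_horizontal, ← sum_sum_mul_eq_sum_dotProduct hb]
  have hlift (y : Fin n → ℝ) :
      horizontalLift φ (hess f x (vecOf y)) = horizontal φ (H.mulVec y) := by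
    rw [horizontalLift_apply]
    congr 1
    ext i
    rw [hess_symm hf2, apply_vecOf]
    rfl
  have hHξ : H.mulVec ξ = g1 (f x) • p := by
    have h1 (y : Fin n → ℝ) : H.mulVec ξ ⬝ᵥ y = g1 (f x) • p ⬝ᵥ y := by
      have h2 := hcrit (vecOf y)
      rw [hlift, apply_horizontal, apply_vecOf] at h2
      rw [smul_dotProduct, smul_eq_mul, ← h2, Matrix.dotProduct_mulVec, ← Matrix.mulVec_transpose,
        hHt]
    exact dotProduct_eq _ _ h1
  set c := g1 (f x) / r with hc
  have hrc : r * c = g1 (f x) := by rw [hc]; field_simp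
  set a := fderiv ℝ F ν (φ 0) with had
  set g0 := hess F ν (φ 0) (φ 0) with hg0d
  -- D²F annihilates ν and p corresponds to ν + φ⁰, so only D²F(φ⁰, φ⁰) is left.
  have hbp : ∑ k, (b k ⬝ᵥ p) ^ 2 = g0 := by
    have h1 := hhess p p
    rw [hpν] at h1
    simp only [map_add, add_apply, hF.hess_self hν,
      hF.hess_self_right hν] at h1
    simp only [pow_two, ← h1]
    simp [hg0d]
  have hreact := reaction_le (b := b) (H := H) (M := M) (p := p) (ξ := ξ) (r := r) (c := c) (a := a)
    (g0 := g0) (m0 := fderiv ℝ (hess F) ν (φ 0) (φ 0) (φ 0)) (ε := ε) (c0 := c0) (c1 := c1) hHt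
    (by rw [← apply_horizontal φ (fderiv ℝ F ν), hpν, map_add, hF.fderiv_self hν])
    (by rw [hHξ, hrc])
    hbp
    (by
      -- Euler's relations applied to D³F(φ⁰, ν + φ⁰, ν + φ⁰) produce the −2g0 behind the favourable
      -- sign.
      have h1 := bilin_horizontal φ (fderiv ℝ (hess F) ν (φ 0)) p p
      rw [hpν] at h1
      simp only [map_add, add_apply, hF.fderiv_hess_apply_self hν,
        hF.fderiv_hess_apply_apply_self hν, hF.hess_self_right hν] at h1
      rw [← h1]
      ring)
    hMij
    (fun ζ hζ => by
      have h1 := hcoer ν hν ζ (by rw [apply_horizontal, dotProduct_comm]; exact hζ)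
      rw [hhess] at h1
      simpa [pow_two] using h1)
    hr1 hc0 hc1 ha hm0 hg0 hθ hε1 hεc hD
  have hGH : ∑ k, b k ⬝ᵥ H.mulVec (b k) = ∑ i, ∑ j, G i j * H i j := by
    rw [sum_sum_mul_eq hb]
    exact Finset.sum_congr rfl fun k _ => dotProduct_mulVec_eq_sum _ _ _
  set GT := ∑ i : Fin n, ∑ j : Fin n, G i j *
    fderiv ℝ (hess f) x (vecOf ξ) (stdVec i) (stdVec j) with hGT
  -- The second-order conditions summed over the b_k; multiplied by r, their third-derivative term
  -- `GT` cancels the one in the derivative of the speed.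
  have hsum : ∑ k, ∑ l, (b k ⬝ᵥ H.mulVec (b l)) ^ 2 + GT - (g2 * g0 +
      g1 (f x) * ∑ i, ∑ j, G i j * H i j) ≤ 0 := by
    have h1 : ∑ k, ∑ l, (b k ⬝ᵥ H.mulVec (b l)) ^ 2 = ∑ k, hess F ν
        (horizontalLift φ (hess f x (vecOf (b k)))) (horizontalLift φ (hess f x (vecOf (b k)))) := by
      rw [Finset.sum_comm]
      refine Finset.sum_congr rfl fun k _ => ?_
      rw [hlift, hhess]
      simp only [pow_two]
    have h2 : GT = ∑ k, fderiv ℝ F ν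
        (horizontalLift φ (fderiv ℝ (hess f) x (vecOf (b k)) (vecOf (b k)))) := by
      rw [hGT, sum_sum_mul_eq hb]
      refine Finset.sum_congr rfl fun k _ => ?_
      rw [horizontalLift_apply, apply_horizontal, dotProduct_comm, ← apply_vecOf,
        fderiv_hess_symm_right hf.contDiffAt, fderiv_hess_symm_left hf.contDiffAt, bilin_vecOf]
    have h3 : g0 = ∑ k, fderiv ℝ f x (vecOf (b k)) ^ 2 := by
      rw [← hbp]
      refine Finset.sum_congr rfl fun k _ => ?_
      rw [apply_vecOf, dotProduct_comm]
    have h4 : ∑ i, ∑ j, G i j * H i j = ∑ k, hess f x (vecOf (b k)) (vecOf (b k)) := by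
      rw [sum_sum_mul_eq hb]
      refine Finset.sum_congr rfl fun k _ => ?_
      rw [bilin_vecOf]
    rw [h1, h2, h3, h4, Finset.mul_sum, Finset.mul_sum, ← Finset.sum_add_distrib,
      ← Finset.sum_add_distrib, ← Finset.sum_sub_distrib]
    exact Finset.sum_nonpos fun k _ => hsec (vecOf (b k))
  have hlξ : horizontalLift φ (hess f x (vecOf ξ)) = g1 (f x) • (ν + φ 0) := by
    rw [hlift, hHξ, ← hpν]
    simp [horizontal, Finset.smul_sum, mul_smul]
  have hDlξ : fderiv ℝ F ν (horizontalLift φ (hess f x (vecOf ξ))) = g1 (f x) * (r + a) := by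
    rw [hlξ, map_smul, map_add, hF.fderiv_self hν, smul_eq_mul]
  have hD3 (i j : Fin n) : fderiv ℝ (hess F) ν (horizontalLift φ (hess f x (vecOf ξ)))
      (φ i.succ) (φ j.succ) = g1 (f x) * (-G i j + M i j) := by
    rw [hlξ]
    simp only [map_smul, map_add, add_apply, smul_apply,
      hF.fderiv_hess_self hν, smul_eq_mul]
    rfl
  have hd : ∑ i : Fin n, ∑ j : Fin n,
      ((fderiv ℝ F ν (horizontalLift φ (hess f x (vecOf ξ))) *
          hess F ν (φ i.succ) (φ j.succ) + r * fderiv ℝ (hess F) ν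
            (horizontalLift φ (hess f x (vecOf ξ))) (φ i.succ) (φ j.succ)) *
          hess f x (stdVec i) (stdVec j) +
        r * hess F ν (φ i.succ) (φ j.succ) *
          fderiv ℝ (hess f) x (vecOf ξ) (stdVec i) (stdVec j)) =
      g1 (f x) * (a * (∑ i, ∑ j, G i j * H i j) + r * (∑ i, ∑ j, M i j * H i j)) + r * GT := by
    simp only [hGT, Finset.mul_sum, ← Finset.sum_add_distrib]
    refine Finset.sum_congr rfl fun i _ => Finset.sum_congr rfl fun j _ => ?_
    rw [hDlξ, hD3]
    simp only [hGd, hHd]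
    ring
  rw [hd]
  rw [hGH] at hreact
  have h1 := mul_le_mul_of_nonneg_left hreact hr0.le
  have h2 := mul_le_mul_of_nonneg_left hsum hr0.le
  have e : r * g0 * (g2 - 3 / 2 * g1 (f x) ^ 2 / r) = r * (g2 * g0) + r * (-(3 / 2) * c ^ 2 * (r * g0)) := by
    rw [hc]
    field_simp
    ring
  rw [e]
  change _ - g1 (f x) * (r * ∑ i, ∑ j, G i j * H i j) ≤ _
  rw [← hrc] at h2 ⊢
  linarith

end SpatialInequality

/-! ### The barrier and its derivatives. -/

section Barrier

/-- `t exp(A (s - σ)² / (2t))` -/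
noncomputable def barrier (A σ s t : ℝ) : ℝ := t * Real.exp (A * (s - σ) ^ 2 / (2 * t))

theorem barrier_pos (A σ s : ℝ) {t : ℝ} (ht : 0 < t) : 0 < barrier A σ s t := by
  unfold barrier; positivity

/-- From exp x ≥ x²/2. The 1/t growth makes the barrier win near t = 0 and keeps it above the
threshold of the asymptotics. -/
theorem div_le_barrier {A σ s t M : ℝ} (hA : 0 ≤ A) (ht : 0 < t) (hM : M ^ 2 ≤ (s - σ) ^ 2) :
    A ^ 2 * M ^ 4 / (8 * t) ≤ barrier A σ s t := by
  have h := Real.quadratic_le_exp_of_nonneg (x := A * (s - σ) ^ 2 / (2 * t)) (by positivity)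
  have h1 : (A * M ^ 2 / (2 * t)) ≤ A * (s - σ) ^ 2 / (2 * t) := by gcongr
  have h0 : 0 ≤ A * M ^ 2 / (2 * t) := by positivity
  calc A ^ 2 * M ^ 4 / (8 * t) = t * ((A * M ^ 2 / (2 * t)) ^ 2 / 2) := by field_simp; ring
    _ ≤ t * Real.exp (A * (s - σ) ^ 2 / (2 * t)) := by
      gcongr
      nlinarith

theorem hasDerivAt_barrier (A σ : ℝ) {t : ℝ} (s : ℝ) :
    HasDerivAt (fun s => barrier A σ s t) (barrier A σ s t * (A * (s - σ) / t)) s := by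
  have h1 : HasDerivAt (fun s => A * (s - σ) ^ 2 / (2 * t)) (A * (s - σ) / t) s := by
    refine HasDerivAt.congr_deriv
      (((((hasDerivAt_id s).sub_const σ).pow 2).const_mul A).div_const (2 * t)) ?_
    simp
    ring
  refine HasDerivAt.congr_deriv (h1.exp.const_mul t) ?_
  unfold barrier
  ring

theorem hasDerivAt_barrier_deriv (A σ : ℝ) {t : ℝ} (s : ℝ) :
    HasDerivAt (fun s => barrier A σ s t * (A * (s - σ) / t))
      (barrier A σ s t * (A / t + (A * (s - σ) / t) ^ 2)) s := by
  have h1 : HasDerivAt (fun s => A * (s - σ) / t) (A / t) s := by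
    simpa using (((hasDerivAt_id s).sub_const σ).const_mul A).div_const t
  refine HasDerivAt.congr_deriv ((hasDerivAt_barrier A σ s).mul h1) ?_
  ring

theorem hasDerivAt_barrier_comp (A σ : ℝ) {t v : ℝ} (ht : 0 < t) {w : ℝ → ℝ}
    (hw : HasDerivAt w v t) :
    HasDerivAt (fun t => barrier A σ (w t) t)
      (barrier A σ (w t) t * (A * (w t - σ) / t * v + 1 / t - A * (w t - σ) ^ 2 / (2 * t ^ 2))) t := by
  have h1 := (((hw.sub_const σ).pow 2).const_mul A).div ((hasDerivAt_id t).const_mul 2)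
    (by simpa using ht.ne')
  refine HasDerivAt.congr_deriv ((hasDerivAt_id t).mul h1.exp) ?_
  unfold barrier
  simp
  field_simp
  ring

theorem continuousOn_barrier (A σ : ℝ) :
    ContinuousOn (fun z : ℝ × ℝ => barrier A σ z.1 z.2) (univ ×ˢ Ioi 0) := by
  unfold barrier
  refine continuousOn_snd.mul (Real.continuous_exp.comp_continuousOn ?_)
  refine ContinuousOn.div (by fun_prop) (by fun_prop) fun z hz => ?_
  have : 0 < z.2 := hz.2
  positivity

/-- Only earlier times are compared, because the maximum may occur at the last time considered. -/
theorem nonneg_of_hasDerivAt_of_le {h : ℝ → ℝ} {h' δ t : ℝ} (hh : HasDerivAt h h' t) (hδ : δ < t)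
    (hle : ∀ s ∈ Icc δ t, h s ≤ h t) : 0 ≤ h' := by
  have h1 := (hasDerivAt_iff_tendsto_slope.1 hh).mono_left
    (nhdsWithin_mono t (fun s (hs : s < t) => hs.ne) : nhdsWithin t (Iio t) ≤ _)
  refine ge_of_tendsto h1 ?_
  filter_upwards [Ioo_mem_nhdsLT hδ] with s hs
  rw [slope_def_field]
  exact div_nonneg_of_nonpos (sub_nonpos.2 (hle s ⟨hs.1.le, hs.2.le⟩)) (sub_nonpos.2 hs.2.le)

end Barrier

/-- A fundamental domain is bounded; with periodicity this lets suprema over ℝⁿ be attained on a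
compact ball. -/
theorem exists_closedBall_translate {n : ℕ} (L : Submodule ℤ (EuclideanSpace ℝ (Fin n)))
    [DiscreteTopology L] [IsZLattice ℝ L] :
    ∃ R, 0 ≤ R ∧ ∀ x, ∃ l ∈ L, x + l ∈ Metric.closedBall (0 : EuclideanSpace ℝ (Fin n)) R := by
  have : Module.Finite ℤ L := ZLattice.module_finite ℝ L
  have : Module.Free ℤ L := ZLattice.module_free ℝ L
  let b := (Module.Free.chooseBasis ℤ L).ofZLatticeBasis ℝ L
  obtain ⟨R, hR⟩ := (ZSpan.fundamentalDomain_isBounded b).subset_closedBall 0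
  refine ⟨max R 0, le_max_right _ _, fun x => ⟨-(ZSpan.floor b x : EuclideanSpace ℝ (Fin n)), ?_, ?_⟩⟩
  · refine L.neg_mem ?_
    exact ((Module.Free.chooseBasis ℤ L).ofZLatticeBasis_span ℝ).le (ZSpan.floor b x).2
  · have h := hR (ZSpan.fract_mem_fundamentalDomain b x)
    rw [ZSpan.fract_apply] at h
    rw [← sub_eq_add_neg]
    exact Metric.closedBall_subset_closedBall (le_max_left _ _) h

/-! ### Regularity of the flow and the time derivative of the density. -/

section Flow

variable {n : ℕ} {φ : Module.Basis (Fin (n + 1)) ℝ (Cotangent n)} {F : Cotangent n → ℝ} {T : ℝ}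
  {u : EuclideanSpace ℝ (Fin n) → ℝ → ℝ}

theorem conormal_add {f : EuclideanSpace ℝ (Fin n) → ℝ} {l : EuclideanSpace ℝ (Fin n)}
    (h : ∀ x, f (x + l) = f x) (x : EuclideanSpace ℝ (Fin n)) :
    conormal φ f (x + l) = conormal φ f x := by
  have h1 : fderiv ℝ f (x + l) = fderiv ℝ f x := by
    rw [← fderiv_comp_add_right]
    simp_rw [h]
  simp only [conormal, h1]

namespace IsFlowSolution

theorem contDiff_slice (hu : IsFlowSolution φ F T u) {t : ℝ} (ht : t ∈ Icc 0 T) :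
    ContDiff ℝ 3 (fun y => u y t) := by
  rw [← contDiffOn_univ]
  exact hu.contDiffOn.comp (f := fun y : EuclideanSpace ℝ (Fin n) => (y, t)) (by fun_prop)
    fun y _ => ⟨mem_univ _, ht⟩

/-- Derivatives within the slab give continuity up to both ends: t = 0 for the bound against which
the barrier starts, t = T for the final limit. -/
theorem continuousOn_conormal (hu : IsFlowSolution φ F T u) (hT : 0 < T) :
    ContinuousOn (fun z : EuclideanSpace ℝ (Fin n) × ℝ => conormal φ (fun y => u y z.2) z.1)
      (univ ×ˢ Icc 0 T) := by
  have hs : UniqueDiffOn ℝ ((univ : Set (EuclideanSpace ℝ (Fin n))) ×ˢ Icc 0 T) :=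
    uniqueDiffOn_univ.prod (uniqueDiffOn_Icc hT)
  have h1 := hu.contDiffOn.continuousOn_fderivWithin hs (by norm_num)
  set U := fun z : EuclideanSpace ℝ (Fin n) × ℝ => u z.1 z.2
  have h2 : ContinuousOn (fun z => (∑ i : Fin n, fderivWithin ℝ U (univ ×ˢ Icc 0 T) z
      (stdVec i, 0) • φ i.succ) - φ 0) (univ ×ˢ Icc 0 T) := by
    refine (continuousOn_finsetSum _ fun i _ => ?_).sub continuousOn_const
    exact (h1.clm_apply continuousOn_const).smul continuousOn_const
  refine h2.congr fun z hz => ?_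
  unfold conormal
  congr 1
  refine Finset.sum_congr rfl fun i _ => ?_
  congr 1
  have h3 := (hu.contDiffOn.differentiableOn (by norm_num) z hz).hasFDerivWithinAt
  have h4 : HasFDerivWithinAt (fun y : EuclideanSpace ℝ (Fin n) => (y, z.2))
      (ContinuousLinearMap.inl ℝ _ ℝ) univ z.1 :=
    (hasFDerivAt_prodMk_left z.1 z.2).hasFDerivWithinAt
  have hmaps : MapsTo (fun y : EuclideanSpace ℝ (Fin n) => (y, z.2)) univ (univ ×ˢ Icc 0 T) :=
    fun y _ => ⟨mem_univ _, hz.2⟩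
  have h5 : HasFDerivAt (fun y => u y z.2) ((fderivWithin ℝ U (univ ×ˢ Icc 0 T) z).comp
      (ContinuousLinearMap.inl ℝ _ ℝ)) z.1 :=
    (HasFDerivWithinAt.comp (g := U) z.1 h3 h4 hmaps).hasFDerivAt Filter.univ_mem
  rw [h5.fderiv]
  simp

theorem contDiffAt (hu : IsFlowSolution φ F T u) {t : ℝ} (ht : t ∈ Ioo 0 T)
    (x : EuclideanSpace ℝ (Fin n)) :
    ContDiffAt ℝ 3 (fun z : EuclideanSpace ℝ (Fin n) × ℝ => u z.1 z.2) (x, t) :=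
  hu.contDiffOn.contDiffAt (prod_mem_nhds Filter.univ_mem (Icc_mem_nhds ht.1 ht.2))

theorem hasDerivAt (hu : IsFlowSolution φ F T u) {t : ℝ} (ht : t ∈ Ioo 0 T)
    (x : EuclideanSpace ℝ (Fin n)) :
    HasDerivAt (fun s => u x s) (anisotropicSpeed φ F (fun y => u y t) x) t :=
  (hu.equation x t (Ioo_subset_Icc_self ht)).hasDerivAt (Icc_mem_nhds ht.1 ht.2)

theorem fderiv_eq_speed (hu : IsFlowSolution φ F T u) {t : ℝ} (ht : t ∈ Ioo 0 T)
    (x : EuclideanSpace ℝ (Fin n)) :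
    fderiv ℝ (fun z : EuclideanSpace ℝ (Fin n) × ℝ => u z.1 z.2) (x, t) (0, 1) =
      anisotropicSpeed φ F (fun y => u y t) x := by
  have h1 := ((hu.contDiffAt ht x).differentiableAt (by norm_num)).hasFDerivAt
  have h2 : HasDerivAt (fun s : ℝ => (x, s)) ((0 : EuclideanSpace ℝ (Fin n)), (1 : ℝ)) t :=
    (hasDerivAt_const t x).prodMk (hasDerivAt_id t)
  exact (h1.comp_hasDerivAt t h2).unique (hu.hasDerivAt ht x)

theorem fderiv_slice (hu : IsFlowSolution φ F T u) {t : ℝ} (ht : t ∈ Ioo 0 T)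
    (x b : EuclideanSpace ℝ (Fin n)) :
    fderiv ℝ (fun y => u y t) x b =
      fderiv ℝ (fun z : EuclideanSpace ℝ (Fin n) × ℝ => u z.1 z.2) (x, t) (b, 0) := by
  have h1 := ((hu.contDiffAt ht x).differentiableAt (by norm_num)).hasFDerivAt
  have h2 : HasFDerivAt (fun y => u y t) ((fderiv ℝ (fun z : EuclideanSpace ℝ (Fin n) × ℝ =>
      u z.1 z.2) (x, t)).comp (ContinuousLinearMap.inl ℝ _ ℝ)) x :=
    HasFDerivAt.comp (f := fun y => (y, t)) x h1 (hasFDerivAt_prodMk_left x t)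
  rw [h2.fderiv]
  simp

/-- The time derivative of the area density is the derivative of the speed in the direction
`∑ DF|_ν(φⁱ) eᵢ`. -/
theorem hasDerivAt_density (hu : IsFlowSolution φ F T u) (hF : IsAnisotropicIntegrand F) {t : ℝ}
    (ht : t ∈ Ioo 0 T) {x : EuclideanSpace ℝ (Fin n)} {d : ℝ}
    (hd : HasDerivAt (fun s : ℝ => anisotropicSpeed φ F (fun y => u y t) (x + s • vecOf
      (fun i => fderiv ℝ F (conormal φ (fun y => u y t) x) (φ i.succ)))) d 0) :
    HasDerivAt (fun s => F (conormal φ (fun y => u y s) x)) d t := by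
  set ν := conormal φ (fun y => u y t) x with hν
  set ξ : Fin n → ℝ := fun i => fderiv ℝ F ν (φ i.succ) with hξ
  set U := fun z : EuclideanSpace ℝ (Fin n) × ℝ => u z.1 z.2
  have hU2 : ContDiffAt ℝ 2 U (x, t) := (hu.contDiffAt ht x).of_le (by norm_num)
  have hγ : HasDerivAt (fun s : ℝ => (x, s)) ((0 : EuclideanSpace ℝ (Fin n)), (1 : ℝ)) t :=
    (hasDerivAt_const t x).prodMk (hasDerivAt_id t)
  have h1 : HasDerivAt (fun s => conormal φ (fun y => u y s) x)
      (horizontal φ (fun i => hess U (x, t) (0, 1) (stdVec i, 0))) t := by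
    have h2 : HasDerivAt (fun s => (∑ i : Fin n, fderiv ℝ U (x, s) (stdVec i, 0) • φ i.succ) - φ 0)
        (horizontal φ (fun i => hess U (x, t) (0, 1) (stdVec i, 0))) t := by
      refine (HasDerivAt.fun_sum fun i _ => ?_).sub_const _
      exact ((hU2.hasFDerivAt_fderiv_apply (stdVec i, 0)).comp_hasDerivAt t hγ).smul_const _
    refine h2.congr_of_eventuallyEq ?_
    filter_upwards [Ioo_mem_nhds ht.1 ht.2] with s hs
    simp only [conormal, hu.fderiv_slice hs]
    rfl
  have h3 : HasDerivAt (fun s : ℝ => fderiv ℝ U (x + s • vecOf ξ, t) (0, 1))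
      (hess U (x, t) (vecOf ξ, 0) (0, 1)) 0 := by
    have hγ' : HasDerivAt (fun s : ℝ => (x + s • vecOf ξ, t)) (vecOf ξ, (0 : ℝ)) 0 :=
      (hasDerivAt_add_smul x (vecOf ξ) 0).prodMk (hasDerivAt_const 0 t)
    have h4 : HasFDerivAt (fun z => fderiv ℝ U z (0, 1))
        ((ContinuousLinearMap.apply ℝ ℝ ((0 : EuclideanSpace ℝ (Fin n)), (1 : ℝ))).comp
          (hess U (x, t))) (x + (0 : ℝ) • vecOf ξ, t) := by
      simpa using hU2.hasFDerivAt_fderiv_apply (0, 1)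
    exact h4.comp_hasDerivAt (0 : ℝ) hγ'
  have h5 : d = hess U (x, t) (vecOf ξ, 0) (0, 1) := by
    refine hd.unique ?_
    simpa only [U, hu.fderiv_eq_speed ht] using h3
  have h6 : HasFDerivAt F (fderiv ℝ F ν) ν :=
    ((hF.contDiffAt ν (conormal_ne_zero φ _ _)).differentiableAt (by norm_num)).hasFDerivAt
  refine HasDerivAt.congr_deriv (h6.comp_hasDerivAt t h1) ?_
  -- Symmetry of the joint second derivative: the time derivative of Du is the gradient of the
  -- speed.
  rw [h5, hess_symm hU2, apply_horizontal, dotProduct_comm]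
  have h7 := apply_vecOf ((hess U (x, t) (0, 1)).comp
    (ContinuousLinearMap.inl ℝ (EuclideanSpace ℝ (Fin n)) ℝ)) ξ
  simpa using h7.symm

end IsFlowSolution

end Flow

/-! ### The maximum principle argument. -/

section GradientEstimate

variable {n : ℕ} {φ : Module.Basis (Fin (n + 1)) ℝ (Cotangent n)} {F : Cotangent n → ℝ}

/-- Both right-hand sides are multiples of 2t − A q², which is negative since A q² ≥ 2M² > M² ≥ 2t;
the factor θA ≥ 2 then makes the upper bound smaller than the lower one. -/
theorem false_of_barrier_inequalities {c0 A q t M r θ g1ut d : ℝ} (hr : 0 < r)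
    (hθ : c0 ≤ θ) (hA : 2 ≤ A) (hAc : 2 ≤ A * c0) (ht : 0 < t) (hM : 0 < M) (htM : t ≤ M ^ 2 / 2)
    (hq : M ^ 2 ≤ q ^ 2)
    (h1 : d - g1ut ≤ θ * (r * (A / t + (A * q / t) ^ 2) - 3 / 2 * (r * (A * q / t)) ^ 2 / r))
    (h2 : 0 ≤ d - g1ut - r * (1 / t - A * q ^ 2 / (2 * t ^ 2))) : False := by
  have e1 : θ * (r * (A / t + (A * q / t) ^ 2) - 3 / 2 * (r * (A * q / t)) ^ 2 / r) =
      r / (2 * t ^ 2) * (θ * A * (2 * t - A * q ^ 2)) := by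
    field_simp; ring
  have e2 : r * (1 / t - A * q ^ 2 / (2 * t ^ 2)) = r / (2 * t ^ 2) * (2 * t - A * q ^ 2) := by
    field_simp
  rw [e1] at h1
  rw [e2] at h2
  have h3 : r / (2 * t ^ 2) * (2 * t - A * q ^ 2) ≤
      r / (2 * t ^ 2) * (θ * A * (2 * t - A * q ^ 2)) := by linarith
  have h4 := le_of_mul_le_mul_left h3 (by positivity)
  have h5 : 0 < A * q ^ 2 - 2 * t := by
    have : 0 < M ^ 2 := by positivity
    nlinarith
  have h6 : 2 ≤ θ * A := by nlinarith
  nlinarith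

theorem exists_density_le_barrier (hF : IsAnisotropicIntegrand F) (hs : SymmetryCondition φ F) :
    ∃ A > 0, ∀ (M T σ : ℝ) (u : EuclideanSpace ℝ (Fin n) → ℝ → ℝ)
      (L : Submodule ℤ (EuclideanSpace ℝ (Fin n))) [DiscreteTopology L] [IsZLattice ℝ L],
      IsFlowSolution φ F T u → 0 < M →
      (∀ x, ∀ t ∈ Icc (0 : ℝ) T, M ^ 2 ≤ (u x t - σ) ^ 2) →
      (∀ l ∈ L, ∀ x, ∀ t ∈ Icc (0 : ℝ) T, u (x + l) t = u x t) →
      ∀ x t, 0 < t → t < T → t ≤ M ^ 2 / 2 → t ≤ M ^ 4 →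
        F (conormal φ (fun y => u y t) x) ≤ barrier A σ (u x t) t := by
  obtain ⟨c0, hc0, S, hS, hspeed⟩ := exists_speed_deriv_le hF hs
  have hA : ∃ A : ℝ, 2 ≤ A ∧ 2 ≤ A * c0 ∧ S ≤ A ^ 2 / 8 := by
    -- Each summand secures one of the three demands.
    refine ⟨2 + 2 / c0 + 8 * S, ?_, ?_, ?_⟩
    · have : 0 < 2 / c0 := by positivity
      linarith
    · have : (2 + 2 / c0 + 8 * S) * c0 = 2 + (2 * c0 + 8 * (S * c0)) := by field_simp; ring
      rw [this]
      have : 0 < S * c0 := by positivity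
      linarith
    · have : 0 < 2 / c0 := by positivity
      nlinarith
  obtain ⟨A, hA2, hAc, hAS⟩ := hA
  refine ⟨A, by linarith, fun M T σ u L _ _ hu hM hσ hper x1 t1 ht1 ht1T ht1M ht1M4 => ?_⟩
  by_contra! hcon
  have hT : 0 < T := ht1.trans ht1T
  obtain ⟨R, hR0, hR⟩ := exists_closedBall_translate L
  set P := fun z : EuclideanSpace ℝ (Fin n) × ℝ => conormal φ (fun y => u y z.2) z.1 with hP
  have hPper (x l : EuclideanSpace ℝ (Fin n)) (t : ℝ) (hl : l ∈ L) (ht : t ∈ Icc 0 T) :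
      P (x + l, t) = P (x, t) := conormal_add (fun y => hper l hl y t ht) x
  have hPc : ContinuousOn (fun z => F (P z)) (univ ×ˢ Icc 0 T) :=
    hF.continuous.comp_continuousOn (hu.continuousOn_conormal hT)
  set B := Metric.closedBall (0 : EuclideanSpace ℝ (Fin n)) R
  have hB : IsCompact B := isCompact_closedBall _ _
  obtain ⟨K, hK⟩ := (hB.prod (isCompact_Icc (a := (0 : ℝ)) (b := T))).exists_bound_of_continuousOn
    (hPc.mono (prod_mono_left (subset_univ _)))
  have hM4 : 0 < A ^ 2 * M ^ 4 := by positivity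
  -- At time δ the barrier is at least |K| + 1, above the bound K for the density, so the maximum
  -- lies strictly later.
  set δ := min (t1 / 2) (A ^ 2 * M ^ 4 / (8 * (|K| + 1))) with hδ
  have hδ0 : 0 < δ := by positivity
  have hδt1 : δ < t1 := (min_le_left _ _).trans_lt (by linarith)
  have hδB (x : EuclideanSpace ℝ (Fin n)) (hx : x ∈ B) :
      F (P (x, δ)) < barrier A σ (u x δ) δ := by
    have h1 : A ^ 2 * M ^ 4 / (8 * δ) ≤ barrier A σ (u x δ) δ :=
      div_le_barrier (by linarith) hδ0 (hσ x δ ⟨hδ0.le, (hδt1.trans ht1T).le⟩)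
    have h2 : |K| + 1 ≤ A ^ 2 * M ^ 4 / (8 * δ) := by
      have h3 : δ ≤ A ^ 2 * M ^ 4 / (8 * (|K| + 1)) := min_le_right _ _
      rw [le_div_iff₀ (by positivity)] at h3 ⊢
      linarith
    have h3 := (le_abs_self _).trans (hK (x, δ) ⟨hx, hδ0.le, (hδt1.trans ht1T).le⟩)
    linarith [le_abs_self K]
  have hsub : (univ : Set (EuclideanSpace ℝ (Fin n))) ×ˢ Icc δ t1 ⊆ univ ×ˢ Icc 0 T :=
    prod_mono_right (Icc_subset_Icc hδ0.le ht1T.le)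
  have hEc : ContinuousOn (fun z : EuclideanSpace ℝ (Fin n) × ℝ => barrier A σ (u z.1 z.2) z.2)
      (univ ×ˢ Icc δ t1) :=
    (continuousOn_barrier A σ).comp ((hu.contDiffOn.continuousOn.mono hsub).prodMk continuousOn_snd)
      fun z hz => ⟨mem_univ _, hδ0.trans_le hz.2.1⟩
  have hQc : ContinuousOn (fun z => F (P z) / barrier A σ (u z.1 z.2) z.2) (univ ×ˢ Icc δ t1) :=
    (hPc.mono hsub).div hEc fun z hz => (barrier_pos _ _ _ (hδ0.trans_le hz.2.1)).ne'
  obtain ⟨⟨x0, t0⟩, ⟨hx0, ht0⟩, hmax⟩ := (hB.prod (isCompact_Icc (a := δ) (b := t1))).exists_isMaxOn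
    ⟨(0, t1), by simp [B, hR0], hδt1.le, le_rfl⟩ (hQc.mono (prod_mono_left (subset_univ _)))
  have hmax' (x : EuclideanSpace ℝ (Fin n)) (t : ℝ) (ht : t ∈ Icc δ t1) :
      F (P (x, t)) / barrier A σ (u x t) t ≤ F (P (x0, t0)) / barrier A σ (u x0 t0) t0 := by
    obtain ⟨l, hl, hxl⟩ := hR x
    have htT : t ∈ Icc 0 T := ⟨hδ0.le.trans ht.1, ht.2.trans ht1T.le⟩
    have h1 : F (P (x + l, t)) / barrier A σ (u (x + l) t) t ≤ _ :=
      hmax (show (x + l, t) ∈ B ×ˢ Icc δ t1 from ⟨hxl, ht⟩)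
    rwa [hPper x l t hl htT, hper l hl x t htT] at h1
  set m := F (P (x0, t0)) / barrier A σ (u x0 t0) t0 with hm
  have ht00 : 0 < t0 := hδ0.trans_le ht0.1
  have hE0 : 0 < barrier A σ (u x0 t0) t0 := barrier_pos _ _ _ ht00
  have hm1 : 1 < m :=
    ((one_lt_div (barrier_pos _ _ _ ht1)).2 hcon).trans_le (hmax' x1 t1 ⟨hδt1.le, le_rfl⟩)
  have hδt0 : δ < t0 := by
    refine lt_of_le_of_ne ht0.1 fun h => ?_
    have h1 := hδB x0 hx0
    rw [h] at h1
    exact hm1.not_ge ((div_le_one hE0).2 h1.le)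
  have ht0T : t0 ∈ Ioo 0 T := ⟨ht00, ht0.2.trans_lt ht1T⟩
  have hle (x : EuclideanSpace ℝ (Fin n)) (t : ℝ) (ht : t ∈ Icc δ t1) :
      F (P (x, t)) - m * barrier A σ (u x t) t ≤ 0 := by
    have := (div_le_iff₀ (barrier_pos A σ (u x t) (hδ0.trans_le ht.1))).1 (hmax' x t ht)
    linarith
  have hr : F (P (x0, t0)) = m * barrier A σ (u x0 t0) t0 := (div_mul_cancel₀ _ hE0.ne').symm
  have hσ0 := hσ x0 t0 (Ioo_subset_Icc_self ht0T)
  -- The asymptotic regime is automatic: m > 1, and t0 ≤ M⁴ makes the barrier at least A²/8 ≥ S.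
  have hrS : S ≤ F (P (x0, t0)) := by
    have h1 := div_le_barrier (A := A) (by linarith) ht00 hσ0
    have h2 : A ^ 2 / 8 ≤ A ^ 2 * M ^ 4 / (8 * t0) := by
      rw [div_le_div_iff₀ (by norm_num) (by positivity)]
      have : t0 ≤ M ^ 4 := ht0.2.trans ht1M4
      have := mul_le_mul_of_nonneg_left this (sq_nonneg A)
      linarith
    rw [hr]
    nlinarith
  have hr0 : 0 < F (P (x0, t0)) := hS.trans_le hrS
  obtain ⟨d, θ, hθ, hd, hineq⟩ := hspeed (fun y => u y t0) (fun s => m * barrier A σ s t0)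
    (fun s => m * (barrier A σ s t0 * (A * (s - σ) / t0)))
    (m * (barrier A σ (u x0 t0) t0 * (A / t0 + (A * (u x0 t0 - σ) / t0) ^ 2))) x0
    (hu.contDiff_slice (Ioo_subset_Icc_self ht0T))
    (fun s => (hasDerivAt_barrier A σ s).const_mul m)
    ((hasDerivAt_barrier_deriv A σ _).const_mul m)
    (Filter.Eventually.of_forall fun x => by
      have h1 := hle x t0 ht0
      have h2 : F (P (x0, t0)) - m * barrier A σ (u x0 t0) t0 = 0 := sub_eq_zero.2 hr
      exact h1.trans h2.ge)
    hrS
  have htime := (hu.hasDerivAt_density hF ht0T hd).sub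
    ((hasDerivAt_barrier_comp A σ ht00 (hu.hasDerivAt ht0T x0)).const_mul m)
  have hnonneg := nonneg_of_hasDerivAt_of_le htime hδt0 fun t ht => by
    have h1 := hle x0 t ⟨ht.1, ht.2.trans ht0.2⟩
    have h2 : F (P (x0, t0)) - m * barrier A σ (u x0 t0) t0 = 0 := sub_eq_zero.2 hr
    exact h1.trans h2.ge
  set v := anisotropicSpeed φ F (fun y => u y t0) x0
  have hr' : F (conormal φ (fun y => u y t0) x0) = F (P (x0, t0)) := rfl
  rw [hr'] at hineq
  set r := F (P (x0, t0))
  refine false_of_barrier_inequalities (q := u x0 t0 - σ)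
    (g1ut := r * (A * (u x0 t0 - σ) / t0) * v) (d := d) hr0 hθ hA2 hAc ht00 hM
    (ht0.2.trans ht1M) hσ0 ?_ ?_
  · simp only [← mul_assoc, ← hr] at hineq ⊢
    exact hineq
  · rw [← mul_assoc, ← hr] at hnonneg
    linarith

end GradientEstimate

/-! ### Conclusion: the two barriers, the final time and the case M = 0. -/

theorem theorem2 :
    ∃ T' : ℝ → ℝ, (∀ M : ℝ, 0 < T' M) ∧
      ∀ (n : ℕ) (φ : Module.Basis (Fin (n + 1)) ℝ (Cotangent n)) (F : Cotangent n → ℝ),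
        IsAnisotropicIntegrand F → SymmetryCondition φ F →
        ∃ A S : ℝ, 0 < A ∧ 0 < S ∧
          ∀ (M T : ℝ) (u : EuclideanSpace ℝ (Fin n) → ℝ → ℝ)
            (L : Submodule ℤ (EuclideanSpace ℝ (Fin n))) [DiscreteTopology L] [IsZLattice ℝ L],
            IsFlowSolution φ F T u →
            (∀ x : EuclideanSpace ℝ (Fin n), ∀ t ∈ Set.Icc (0 : ℝ) T, |u x t| ≤ M) →
            (∀ l ∈ L, ∀ x : EuclideanSpace ℝ (Fin n), ∀ t ∈ Set.Icc (0 : ℝ) T,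
              u (x + l) t = u x t) →
            ∀ (x : EuclideanSpace ℝ (Fin n)) (t : ℝ), 0 < t → t ≤ T → t ≤ T' M →
              F (conormal φ (fun y => u y t) x) ≤
                max (t * Real.exp (A * (|u x t| - 2 * M) ^ 2 / (2 * t))) S := by
  -- M²/2 gives A q² > 2t and M⁴ puts the barrier above the threshold; the value at M = 0 only has
  -- to be positive.
  refine ⟨fun M => if M = 0 then 1 else min (M ^ 2 / 2) (M ^ 4), fun M => ?_,
    fun n φ F hF hs => ?_⟩
  · dsimp only
    split_ifs <;> positivity
  obtain ⟨A, hA, h⟩ := exists_density_le_barrier hF hs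
  have hφ : -φ 0 ≠ 0 := neg_ne_zero.2 (φ.ne_zero 0)
  -- This S serves only M = 0, where u vanishes and ν = −φ⁰; for M > 0 the exponential term alone
  -- bounds the density.
  refine ⟨A, F (-φ 0), hA, hF.pos _ hφ, fun M T u L _ _ hu hbound hper x t ht htT htT' => ?_⟩
  have htmem : t ∈ Icc 0 T := ⟨ht.le, htT⟩
  have hM0 : 0 ≤ M := (abs_nonneg _).trans (hbound x t htmem)
  rcases hM0.eq_or_lt with rfl | hM
  · have h0 : (fun y => u y t) = fun _ => 0 :=
      funext fun y => abs_nonpos_iff.1 (hbound y t htmem)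
    rw [h0]
    simp [conormal]
  simp only [hM.ne', if_false, le_min_iff] at htT'
  refine le_max_of_le_left ?_
  -- the estimate for either sign of `u`, up to and including the final time
  have key (σ : ℝ) (hσ : |σ| = 2 * M) :
      F (conormal φ (fun y => u y t) x) ≤ barrier A σ (u x t) t := by
    have hsq (x : EuclideanSpace ℝ (Fin n)) (t : ℝ) (ht : t ∈ Icc 0 T) :
        M ^ 2 ≤ (u x t - σ) ^ 2 := by
      have h1 := hbound x t ht
      have h2 := abs_sub_abs_le_abs_sub σ (u x t)
      rw [abs_sub_comm] at h2
      rw [← sq_abs (u x t - σ)]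
      gcongr
      linarith
    have hlt (t' : ℝ) (ht' : t' ∈ Ioo 0 t) :
        F (conormal φ (fun y => u y t') x) ≤ barrier A σ (u x t') t' :=
      h M T σ u L hu hM hsq hper x t' ht'.1 (ht'.2.trans_le htT) (ht'.2.le.trans htT'.1)
        (ht'.2.le.trans htT'.2)
    have hT : 0 < T := ht.trans_le htT
    have hline : ContinuousWithinAt (fun s : ℝ => (x, s)) (Ioo 0 t) t := by fun_prop
    have hmaps : MapsTo (fun s : ℝ => (x, s)) (Ioo 0 t) (univ ×ˢ Icc 0 T) :=
      fun s hs => ⟨mem_univ _, hs.1.le, hs.2.le.trans htT⟩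
    have hc1 : ContinuousWithinAt (fun s => F (conormal φ (fun y => u y s) x)) (Ioo 0 t) t :=
      hF.continuous.continuousAt.comp_continuousWithinAt
        (((hu.continuousOn_conormal hT) (x, t) ⟨mem_univ _, htmem⟩).comp hline hmaps)
    have hc2 : ContinuousWithinAt (fun s => barrier A σ (u x s) s) (Ioo 0 t) t :=
      ContinuousWithinAt.comp (f := fun s => (u x s, s)) (continuousOn_barrier A σ (u x t, t)
        ⟨mem_univ _, ht⟩) (((hu.contDiffOn.continuousOn (x, t) ⟨mem_univ _, htmem⟩).comp hline
          hmaps).prodMk continuousWithinAt_id) fun s hs => ⟨mem_univ _, hs.1⟩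
    have : (nhdsWithin t (Ioo 0 t)).NeBot := right_nhdsWithin_Ioo_neBot ht
    exact le_of_tendsto_of_tendsto hc1 hc2 (eventually_nhdsWithin_of_forall hlt)
  -- The centre σ = ±2M takes the sign of u(x, t), so that (u − σ)² = (|u| − 2M)².
  rcases le_total 0 (u x t) with hu0 | hu0
  · rw [abs_of_nonneg hu0]
    exact key (2 * M) (abs_of_pos (by linarith))
  · have := key (-(2 * M)) (by rw [abs_neg, abs_of_pos (by linarith)])
    have e : (-u x t - 2 * M) ^ 2 = (u x t - -(2 * M)) ^ 2 := by ring
    rw [abs_of_nonpos hu0, e]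
    exact this
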